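/- **Setting.** Fix $k\ge 1$. A line in $\mathbb R^n$ is a pair $(x,\theta)\in\mathbb R^n\times\mathbb S^{n-1}$ (source and direction), and $\mathbb L^n_k=(\mathbb R^n\times\mathbb S^{n-1})^k$ is the space of systems of $k$ lines. The Euclidean group $\mathrm E(n)$ acts on $\mathbb R^n$ by $gy=Qy+a$ and on systems of lines by $g(x_i,\theta_i)_i=(Qx_i+a,Q\theta_i)_i$. A splitting map is a continuous map $\alpha:\mathbb R^n\times\mathbb L^n_k\to\Delta_{k-1}$ into the standard simplex; it is $\mathrm E(n)$-invariant if $\alpha(gy,g\mathcal L)=\alpha(y,\mathcal L)$ for all $g,y,\mathcal L$. Fix a tree $G$ on the index set $\{1,\dots,k\}$ (the tree structure). A tree system with structure $G$ is a system of lines $(x_i,\theta_i)_i$ together with gluing coordinates $s_{ij}\in\mathbb R$ for the edges $ij$ of $G$ such that $x_i+s_{ij}\theta_i=x_j+s_{ji}\theta_j$; the $k$ lines (as disjoint copies of $\mathbb R$, the point with coordinate $t$ on line $i$ being written $x_i+t\theta_i$) are glued at these points, and $d_{\mathcal L}$ is the resulting tree metric, i.e. the length of the shortest route from one point to the other which changes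 lines only at the gluing points. $\mathrm E(n)$ acts on tree systems by moving the lines and keeping the $s_{ij}$. $\mathrm W_{\mathcal L}(m,m')=\inf_\pi\int d_{\mathcal L}\,d\pi\in[0,\infty]$, over all couplings $\pi$ of $m$ and $m'$, is the order-one Wasserstein distance between probability measures on $\mathcal L$. A space of trees $\mathbb T$ is a set of tree systems in $\mathbb R^n$ with structure $G$ that is stable under $\mathrm E(n)$, with the topology given by the lines and the gluing coordinates. Let $\sigma$ be a Borel probability measure on $\mathbb T$ that charges every non-empty relatively open subset of $\mathbb T$. For a Borel probability measure $\mu$ on $\mathbb R^d$, the following transforms are probability measures on $\mathcal L$. * *CRTSL*, for $n=d$ and a fixed $r\ge 0$: the part of $\mathcal{CR}^\alpha_{\mathcal L,r}\mu$ on line $i$ is the image of the measure $\alpha(y,\mathcal L)_i\,\mu(dy)$ under $y\mapsto \|y-x_i-r\theta_i\|_2$. If $\mu$ has a density $f$, this is what is meant by $\int f(y)\,\alpha(y,\mathcal L)_i\,\delta(t-\|y-x_i-r\theta_i\|_2)\,dy$. * *SRTSL*, for $n=d_\theta$ and a continuous injective $h:\mathbb R^d\to\mathbb R^{d_\theta}$: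 the part of $\mathcal H^\alpha_{\mathcal L}\mu$ on line $i$ is the image of the measure $\alpha(h(y),\mathcal L)_i\,\mu(dy)$ under $y\mapsto\langle h(y)-x_i,\theta_i\rangle$. Define $$\mathrm{CircularTSW}(\mu,\nu)=\int_{\mathbb T}\mathrm W_{\mathcal L}\big(\mathcal{CR}^\alpha_{\mathcal L,r}\mu,\mathcal{CR}^\alpha_{\mathcal L,r}\nu\big)\,d\sigma(\mathcal L),\qquad \mathrm{SpatialTSW}(\mu,\nu)=\int_{\mathbb T}\mathrm W_{\mathcal L}\big(\mathcal{H}^\alpha_{\mathcal L}\mu,\mathcal{H}^\alpha_{\mathcal L}\nu\big)\,d\sigma(\mathcal L),$$ where $\mathbb T$, $\sigma$ live in dimension $n=d$ for the first and $n=d_\theta$ for the second. **Theorem.** Let $\alpha$ be an $\mathrm E(d)$-invariant (for CircularTSW), respectively $\mathrm E(d_\theta)$-invariant (for SpatialTSW), splitting map, and $r\ge0$, respectively $h$ continuous and injective, be fixed. Then the integrands above are measurable in $\mathcal L$, and: 1. On the set of all Borel probability measures on $\mathbb R^d$, CircularTSW and SpatialTSW satisfy all axioms of a metric, with the value $\infty$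 allowed: the distance is $0$ if and only if $\mu=\nu$, it is symmetric, and it satisfies the triangle inequality. 2. If moreover $\int_{\mathbb T}\big(\sum_i\|x_i\|+\sum_{ij\in G}(|s_{ij}|+|s_{ji}|)\big)\,d\sigma<\infty$, then CircularTSW is a (finite) metric on the set of Borel probability measures $\mu$ on $\mathbb R^d$ with $\int\|y\|\,d\mu<\infty$, and SpatialTSW is a (finite) metric on the set of those with $\int\|h(y)\|\,d\mu<\infty$. -/

import Mathlib

open MeasureTheory
open scoped ENNReal

noncomputable section

namespace TreeSliced

/-- `ℝ^d` with the Euclidean norm. -/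
abbrev E (d : ℕ) : Type := EuclideanSpace ℝ (Fin d)

/-- A line in `ℝ^d`: a source and a unit direction. -/
abbrev Line (d : ℕ) : Type := E d × Metric.sphere (0 : E d) 1

/-- The space of systems of `k` lines in `ℝ^d`. -/
abbrev LineSystem (d k : ℕ) : Type := Fin k → Line d

/-- The source of the `i`-th line. -/
def LineSystem.source {d k : ℕ} (L : LineSystem d k) (i : Fin k) : E d := (L i).1

/-- The direction of the `i`-th line. -/
def LineSystem.dir {d k : ℕ} (L : LineSystem d k) (i : Fin k) : E d := (L i).2

/-- The Euclidean group: all isometries `y ↦ Q y + a` of `ℝ^d`. -/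
abbrev EuclideanGroup (d : ℕ) : Type := E d ≃ᵃⁱ[ℝ] E d

/-- The action of the Euclidean group on lines, `(x, θ) ↦ (Q x + a, Q θ)`. -/
def moveLine {d : ℕ} (g : EuclideanGroup d) (l : Line d) : Line d :=
  (g l.1, ⟨g.linearIsometryEquiv (l.2 : E d), by
    have h : ‖(l.2 : E d)‖ = 1 := by simp
    simp [h]⟩)

/-- The action of the Euclidean group on systems of lines. -/
def moveLines {d k : ℕ} (g : EuclideanGroup d) (L : LineSystem d k) : LineSystem d k :=
  fun i => moveLine g (L i)

/-- A tree system with tree structure `G` (a tree whose nodes are the lines): a system of lines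
together with gluing coordinates. For an edge `i - j`, the point with coordinate `s i j` on line `i`
and the point with coordinate `s j i` on line `j` are the same point of `ℝ^d`, and the two lines are
glued there. Off the edges `s` carries no information and is set to `0`. -/
def IsTreeSystem {d k : ℕ} (G : SimpleGraph (Fin k))
    (T : LineSystem d k × (Fin k → Fin k → ℝ)) : Prop :=
  (∀ i j, G.Adj i j →
    T.1.source i + T.2 i j • T.1.dir i = T.1.source j + T.2 j i • T.1.dir j) ∧
  (∀ i j, ¬ G.Adj i j → T.2 i j = 0)

/-- All tree systems with tree structure `G`, with the topology and the Borel σ-algebra induced by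
the lines and the gluing coordinates. -/
abbrev TreeSystem (d : ℕ) {k : ℕ} (G : SimpleGraph (Fin k)) : Type :=
  {T : LineSystem d k × (Fin k → Fin k → ℝ) // IsTreeSystem G T}

namespace TreeSystem

variable {d k : ℕ} {G : SimpleGraph (Fin k)}

/-- The underlying system of lines. -/
def lines (T : TreeSystem d G) : LineSystem d k := T.1.1

/-- The gluing coordinates. -/
def glue (T : TreeSystem d G) : Fin k → Fin k → ℝ := T.1.2

/-- The action of the Euclidean group on tree systems: it moves the lines and keeps the gluing. -/
def move (g : EuclideanGroup d) (T : TreeSystem d G) : TreeSystem d G :=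
  ⟨(moveLines g T.lines, T.glue), by
    refine ⟨fun i j hij => ?_, T.2.2⟩
    have h := T.2.1 i j hij
    have key : ∀ (x v : E d) (t : ℝ), g x + t • g.linearIsometryEquiv v = g (x + t • v) := by
      intro x v t
      have h1 := g.map_vadd x (t • v)
      simp only [vadd_eq_add, map_smul] at h1
      rw [add_comm x, h1, add_comm]
    change g (T.lines.source i) + T.glue i j • g.linearIsometryEquiv (T.lines.dir i)
      = g (T.lines.source j) + T.glue j i • g.linearIsometryEquiv (T.lines.dir j)
    rw [key, key]
    exact congrArg g h⟩

end TreeSystem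

/-- The points of a system of `k` lines: `(i, t)` is the point with coordinate `t` on line `i`. -/
abbrev TreePoint (k : ℕ) : Type := Fin k × ℝ

/-- The length of the route from coordinate `t` on line `i` to coordinate `u` on line `j` that
passes through the lines of the walk, changing lines at the gluing points. -/
def routeLength {k : ℕ} {G : SimpleGraph (Fin k)} (s : Fin k → Fin k → ℝ) :
    {i j : Fin k} → G.Walk i j → ℝ → ℝ → ℝ
  | _, _, .nil, t, u => |t - u|
  | i, _, .cons (v := v) _ p, t, u => |t - s i v| + routeLength s p (s v i) u

/-- The tree metric: the length of the shortest route. Two points have distance `0` exactly if they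
are identified by the gluing. -/
def treeDist {d k : ℕ} {G : SimpleGraph (Fin k)} (T : TreeSystem d G) (p q : TreePoint k) : ℝ :=
  ⨅ w : G.Walk p.1 q.1, routeLength T.glue w p.2 q.2

/-- The Wasserstein distance of order one with ground distance `c`: the infimum of the transport
costs over all couplings. -/
def wasserstein {Ω : Type*} [MeasurableSpace Ω] (c : Ω → Ω → ℝ) (μ ν : Measure Ω) : ℝ≥0∞ :=
  ⨅ (π : Measure (Ω × Ω)) (_ : π.map Prod.fst = μ) (_ : π.map Prod.snd = ν),
    ∫⁻ p, ENNReal.ofReal (c p.1 p.2) ∂π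

/-- Splitting maps: continuous maps into the standard simplex. -/
abbrev SplittingMap (d k : ℕ) : Type := C(E d × LineSystem d k, stdSimplex ℝ (Fin k))

/-- Invariance of a splitting map under the Euclidean group. -/
def SplittingMap.IsInvariant {d k : ℕ} (α : SplittingMap d k) : Prop :=
  ∀ (g : EuclideanGroup d) (y : E d) (L : LineSystem d k), α (g y, moveLines g L) = α (y, L)

/-- Split the mass at `y` into the portions `a y i` and send the `i`-th portion to the point with
coordinate `c y i` on the `i`-th line. For `μ = f dy`, the restriction to the `i`-th line is the
measure written `(∫ f y * a y i * δ (t - c y i) dy) dt`. -/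
def splitAndProject {X : Type*} [MeasurableSpace X] {k : ℕ} (a c : X → Fin k → ℝ)
    (μ : Measure X) : Measure (TreePoint k) :=
  ∑ i, (μ.withDensity fun y => ENNReal.ofReal (a y i)).map fun y => (i, c y i)

/-- The circular Radon transform on systems of lines, with radius `r`. -/
def circularRadon {d k : ℕ} (α : SplittingMap d k) (r : ℝ) (L : LineSystem d k)
    (μ : Measure (E d)) : Measure (TreePoint k) :=
  splitAndProject (fun y i => (α (y, L)).1 i)
    (fun y i => ‖y - L.source i - r • L.dir i‖) μ

/-- The spatial Radon transform on systems of lines, with the map `h`. -/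
def spatialRadon {d e k : ℕ} (α : SplittingMap e k) (h : E d → E e) (L : LineSystem e k)
    (μ : Measure (E d)) : Measure (TreePoint k) :=
  splitAndProject (fun y i => (α (h y, L)).1 i)
    (fun y i => inner ℝ (h y - L.source i) (L.dir i)) μ

/-- The Wasserstein distance on the tree `T` between the circular transforms. -/
def circularW {d k : ℕ} {G : SimpleGraph (Fin k)} (α : SplittingMap d k) (r : ℝ)
    (μ ν : ProbabilityMeasure (E d)) (T : TreeSystem d G) : ℝ≥0∞ :=
  wasserstein (treeDist T) (circularRadon α r T.lines μ) (circularRadon α r T.lines ν)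

/-- The Wasserstein distance on the tree `T` between the spatial transforms. -/
def spatialW {d e k : ℕ} {G : SimpleGraph (Fin k)} (α : SplittingMap e k) (h : E d → E e)
    (μ ν : ProbabilityMeasure (E d)) (T : TreeSystem e G) : ℝ≥0∞ :=
  wasserstein (treeDist T) (spatialRadon α h T.lines μ) (spatialRadon α h T.lines ν)

/-- The Circular Tree-Sliced Wasserstein distance for the law `σ` on the space of trees `𝕋`. -/
def circularTSW {d k : ℕ} {G : SimpleGraph (Fin k)} (α : SplittingMap d k) (r : ℝ)
    {𝕋 : Set (TreeSystem d G)} (σ : Measure 𝕋) (μ ν : ProbabilityMeasure (E d)) : ℝ≥0∞ :=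
  ∫⁻ T : 𝕋, circularW α r μ ν T.1 ∂σ

/-- The Spatial Tree-Sliced Wasserstein distance for the law `σ` on the space of trees `𝕋`. -/
def spatialTSW {d e k : ℕ} {G : SimpleGraph (Fin k)} (α : SplittingMap e k) (h : E d → E e)
    {𝕋 : Set (TreeSystem e G)} (σ : Measure 𝕋) (μ ν : ProbabilityMeasure (E d)) : ℝ≥0∞ :=
  ∫⁻ T : 𝕋, spatialW α h μ ν T.1 ∂σ

/-- A space of trees is stable under the action of the Euclidean group. -/
def IsEuclideanStable {d k : ℕ} {G : SimpleGraph (Fin k)} (𝕋 : Set (TreeSystem d G)) : Prop :=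
  ∀ (g : EuclideanGroup d), ∀ T ∈ 𝕋, T.move g ∈ 𝕋

/-- The law of the trees has finite first moment: the sources and the gluing coordinates are
integrable. -/
def TreeLawHasFirstMoment {d k : ℕ} {G : SimpleGraph (Fin k)} {𝕋 : Set (TreeSystem d G)}
    (σ : Measure 𝕋) : Prop :=
  Integrable (fun T : 𝕋 => (∑ i, ‖T.1.lines.source i‖) + ∑ i, ∑ j, |T.1.glue i j|) σ

/-- The axioms of a metric, with the value `∞` allowed. -/
structure IsExtendedMetric {X : Type*} (D : X → X → ℝ≥0∞) : Prop where
  eq_zero_iff : ∀ x y, D x y = 0 ↔ x = y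
  symm : ∀ x y, D x y = D y x
  triangle : ∀ x y z, D x z ≤ D x y + D y z

/-- `D` is a (finite) metric on the set `S`. -/
structure IsMetricOn {X : Type*} (S : Set X) (D : X → X → ℝ≥0∞) : Prop where
  ne_top : ∀ x ∈ S, ∀ y ∈ S, D x y ≠ ∞
  eq_zero_iff : ∀ x ∈ S, ∀ y ∈ S, (D x y = 0 ↔ x = y)
  symm : ∀ x ∈ S, ∀ y ∈ S, D x y = D y x
  triangle : ∀ x ∈ S, ∀ y ∈ S, ∀ z ∈ S, D x z ≤ D x y + D y z

end TreeSliced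

end

open TreeSliced

noncomputable section

namespace TreeSliced

open Filter Topology
open scoped InnerProductSpace

/-! ### Lengths of routes along walks of the gluing graph. -/

section Routes

variable {k : ℕ} {G : SimpleGraph (Fin k)} (s : Fin k → Fin k → ℝ)

/-! Symmetry, the triangle inequality and vanishing on the diagonal hold on each tree and survive
integration over `σ`, once the integrand is known to be measurable. It is in fact lower
semicontinuous in the tree. The transforms depend weakly continuously on the lines. The tree metrics
depend uniformly continuously on the gluing coordinates, because the shortest route always follows
the unique path of `G`. Couplings of convergent marginals are tight, so almost optimal ones
subconverge to a coupling of the limits (`wasserstein_le_of_tendsto`).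

The substance is separation. If the distance is zero, then the Wasserstein distance vanishes on
almost every tree, and there bounded Lipschitz functions have equal integrals. Take such a function
`ψ` on line `i`, vanishing at the gluing points: the integrals of `a y L i * ψ (c y L i)` against
`μ` and `ν` agree. Both sides are continuous in the tree and `σ` charges open sets, so this extends
to every tree of `𝕋` (`integral_eq_of_radonTSW_eq_zero`). Stability of `𝕋` and invariance of the
transform then turn one tree into all its Euclidean motions: some continuous `F ≥ 0`, not
identically zero, satisfies `∫ F (g y) dμ = ∫ F (g y) dν` for all motions `g`.

In the circular case `F` has compact support, so translations suffice: the characteristic functions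
agree after multiplication by the Fourier transform of `F`, whose zeros cannot fill an interval of a
line through the origin (`eq_of_forall_integral_translate_eq`). In the spatial case `F` lives on a
slab and need not be integrable. But the coordinate is linear in `y`, so rotating the line into the
direction of a frequency `ξ` allows `F` to be multiplied by the character at `ξ`. Averaging the
translates of this modulated function against a slowly varying weight replaces `F` by a nearly
constant factor, and the characteristic functions at `ξ` agree in the limit
(`charFun_eq_of_forall_integral_modulated_eq`). A map `h` only pushes the measures forward,
injectively.

Finiteness comes from the product coupling and first moments. -/

theorem routeLength_nonneg {i j : Fin k} (w : G.Walk i j) (t u : ℝ) :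
    0 ≤ routeLength s w t u := by
  induction w generalizing t with
  | nil => exact abs_nonneg _
  | cons h p ih => exact add_nonneg (abs_nonneg _) (ih _)

theorem routeLength_append_le {i j l : Fin k} (p : G.Walk i j) (q : G.Walk j l) (t u v : ℝ) :
    routeLength s (p.append q) t v ≤ routeLength s p t u + routeLength s q u v := by
  induction p generalizing t with
  | @nil i =>
    cases q with
    | nil => exact abs_sub_le _ _ _
    | @cons _ v _ h q =>
      simp only [SimpleGraph.Walk.nil_append, routeLength]
      linarith [abs_sub_le t u (s i v)]
  | @cons a b _ h p ih =>
    simp only [SimpleGraph.Walk.cons_append, routeLength]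
    linarith [ih q (s b a)]

theorem routeLength_concat {i j l : Fin k} (p : G.Walk i j) (h : G.Adj j l) (t u : ℝ) :
    routeLength s (p.concat h) t u = routeLength s p t (s j l) + |s l j - u| := by
  induction p generalizing t with
  | nil => simp [SimpleGraph.Walk.concat, routeLength]
  | cons h' p ih =>
    rw [SimpleGraph.Walk.concat_cons]
    simp only [routeLength]
    rw [ih]; ring

theorem routeLength_reverse {i j : Fin k} (w : G.Walk i j) (t u : ℝ) :
    routeLength s w.reverse u t = routeLength s w t u := by
  induction w generalizing t with
  | nil => simp [routeLength, abs_sub_comm]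
  | cons h p ih =>
    rw [SimpleGraph.Walk.reverse_cons, ← SimpleGraph.Walk.concat_eq_append, routeLength_concat, ih]
    simp only [routeLength]
    rw [abs_sub_comm t]; ring

/-- Changing lines is free for `φ`, which takes the same value on both sides of a gluing. Such
functions give lower bounds for the tree metric and serve as test functions for the Wasserstein
distance. -/
theorem abs_sub_le_routeLength {φ : TreePoint k → ℝ} {C : ℝ}
    (hLip : ∀ i t u, |φ (i, t) - φ (i, u)| ≤ C * |t - u|)
    (hglue : ∀ i j, G.Adj i j → φ (i, s i j) = φ (j, s j i))
    {i j : Fin k} (w : G.Walk i j) (t u : ℝ) :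
    |φ (i, t) - φ (j, u)| ≤ C * routeLength s w t u := by
  induction w generalizing t with
  | nil => exact hLip _ _ _
  | @cons i v j h p ih =>
    simp only [routeLength]
    have h1 := hLip i t (s i v)
    rw [hglue i v h] at h1
    have := abs_sub_le (φ (i, t)) (φ (v, s v i)) (φ (j, u))
    linarith [ih (s v i)]

theorem abs_routeLength_sub_right {i j : Fin k} (w : G.Walk i j) (t u u' : ℝ) :
    |routeLength s w t u - routeLength s w t u'| ≤ |u - u'| := by
  induction w generalizing t with
  | nil =>
    simp only [routeLength]
    have := abs_abs_sub_abs_le (t - u) (t - u')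
    rwa [sub_sub_sub_cancel_left, abs_sub_comm u'] at this
  | cons h p ih => simpa [routeLength] using ih _

/-- Each edge of the walk involves two gluing coordinates, and the length is 1-Lipschitz in each of
them. -/
theorem abs_routeLength_sub_glue (s' : Fin k → Fin k → ℝ) {i j : Fin k} (w : G.Walk i j)
    (t u : ℝ) :
    |routeLength s w t u - routeLength s' w t u| ≤ 2 * w.length * dist s s' := by
  have hd : ∀ i j, |s i j - s' i j| ≤ dist s s' := fun i j =>
    (dist_le_pi_dist (s i) (s' i) j).trans (dist_le_pi_dist s s' i)
  induction w generalizing t with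
  | nil => simp [routeLength]
  | @cons i v j h p ih =>
    simp only [routeLength, SimpleGraph.Walk.length_cons]
    have h1 := ih (s v i)
    -- The starting coordinate moves from `s v i` to `s' v i`; reversing the walk reduces this to
    -- the bound for the final coordinate.
    have h2 : |routeLength s' p (s v i) u - routeLength s' p (s' v i) u| ≤ dist s s' := by
      have := abs_routeLength_sub_right s' p.reverse u (s v i) (s' v i)
      simp only [routeLength_reverse] at this
      exact this.trans (hd _ _)
    have h3 : |(|t - s i v|) - (|t - s' i v|)| ≤ dist s s' := by
      have := abs_abs_sub_abs_le (t - s i v) (t - s' i v)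
      rw [sub_sub_sub_cancel_left, abs_sub_comm (s' i v)] at this
      exact this.trans (hd _ _)
    rw [abs_le] at *
    push_cast
    constructor <;> linarith [h1.1, h1.2, h2.1, h2.2, h3.1, h3.2]

theorem routeLength_le {i j : Fin k} (w : G.Walk i j) (t u : ℝ) :
    routeLength s w t u ≤ |t| + |u| + 2 * w.length * ∑ i, ∑ j, |s i j| := by
  have hd : ∀ i j, |s i j| ≤ ∑ i, ∑ j, |s i j| := fun i j =>
    (Finset.single_le_sum (f := fun j => |s i j|) (fun _ _ => abs_nonneg _)
      (Finset.mem_univ j)).trans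
      (Finset.single_le_sum (f := fun i => ∑ j, |s i j|)
        (fun _ _ => Finset.sum_nonneg fun _ _ => abs_nonneg _) (Finset.mem_univ i))
  induction w generalizing t with
  | nil => simpa [routeLength] using abs_sub t u
  | @cons i v j h p ih =>
    simp only [routeLength, SimpleGraph.Walk.length_cons]
    push_cast
    linarith [ih (s v i), hd i v, hd v i, abs_sub t (s i v)]

end Routes

/-! ### The tree metric and its dependence on the gluing. -/

section TreeDist

variable {d k : ℕ} {G : SimpleGraph (Fin k)} (T : TreeSystem d G)

theorem bddBelow_routeLength (p q : TreePoint k) :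
    BddBelow (Set.range fun w : G.Walk p.1 q.1 => routeLength T.glue w p.2 q.2) :=
  ⟨0, by rintro _ ⟨w, rfl⟩; exact routeLength_nonneg _ _ _ _⟩

theorem treeDist_le_routeLength (p q : TreePoint k) (w : G.Walk p.1 q.1) :
    treeDist T p q ≤ routeLength T.glue w p.2 q.2 :=
  ciInf_le (bddBelow_routeLength T p q) w

theorem treeDist_nonneg (p q : TreePoint k) : 0 ≤ treeDist T p q :=
  Real.iInf_nonneg fun _ => routeLength_nonneg _ _ _ _

theorem treeDist_self (p : TreePoint k) : treeDist T p p = 0 :=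
  le_antisymm ((treeDist_le_routeLength T p p .nil).trans (by simp [routeLength]))
    (treeDist_nonneg T p p)

theorem treeDist_comm (p q : TreePoint k) : treeDist T p q = treeDist T q p := by
  unfold treeDist
  refine Function.Surjective.iInf_congr SimpleGraph.Walk.reverse
    SimpleGraph.Walk.reverse_surjective fun w => routeLength_reverse _ _ _ _

theorem treeDist_triangle (hG : G.IsTree) (p q r : TreePoint k) :
    treeDist T p r ≤ treeDist T p q + treeDist T q r := by
  have : ∀ a b, Nonempty (G.Walk a b) := fun a b => hG.connected.preconnected a b
  refine le_ciInf_add_ciInf fun w w' => ?_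
  exact (treeDist_le_routeLength T p r (w.append w')).trans (routeLength_append_le _ _ _ _ _ _)

theorem abs_sub_le_treeDist (hG : G.IsTree) {φ : TreePoint k → ℝ} {C : ℝ} (hC : 0 ≤ C)
    (hLip : ∀ i t u, |φ (i, t) - φ (i, u)| ≤ C * |t - u|)
    (hglue : ∀ i j, G.Adj i j → φ (i, T.glue i j) = φ (j, T.glue j i)) (p q : TreePoint k) :
    |φ p - φ q| ≤ C * treeDist T p q := by
  have : Nonempty (G.Walk p.1 q.1) := hG.connected.preconnected _ _
  rw [treeDist, Real.mul_iInf_of_nonneg hC]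
  exact le_ciInf fun w => abs_sub_le_routeLength _ hLip hglue w p.2 q.2

/-- The shortest route follows the path of the tree. -/
theorem treeDist_eq_routeLength (hG : G.IsTree) (p q : TreePoint k) (w : G.Walk p.1 q.1)
    (hw : w.IsPath) :
    treeDist T p q = routeLength T.glue w p.2 q.2 := by
  refine le_antisymm (treeDist_le_routeLength T p q w) ?_
  choose P hP hPu using fun j => hG.existsUnique_path p.1 j
  -- The route length from `p` along the path to `r`, as a potential: it is 1-Lipschitz on each line
  -- and compatible with the gluing, hence 1-Lipschitz for the tree metric.
  set φ : TreePoint k → ℝ := fun r => routeLength T.glue (P r.1) p.2 r.2 with hφ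
  have hglue : ∀ i j, G.Adj i j → φ (i, T.glue i j) = φ (j, T.glue j i) := by
    have key : ∀ i j (h : G.Adj i j), P j = (P i).concat h →
        φ (i, T.glue i j) = φ (j, T.glue j i) := by
      intro i j h hc
      simp only [hφ, hc, routeLength_concat]
      simp
    intro i j h
    -- For adjacent `i` and `j`, one of the two paths from `p.1` is the other one extended by the
    -- edge.
    by_cases hv : i ∈ (P j).support
    · exact key i j h (hG.isAcyclic.path_concat (hP i) (hP j) h hv)
    · refine (key j i h.symm ?_).symm
      exact (hPu i _ ((hP j).concat hv h.symm)).symm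
  have := abs_sub_le_treeDist T hG (φ := φ) zero_le_one
    (fun i t u => by simpa using abs_routeLength_sub_right _ _ _ _ _) hglue q p
  have h0 : φ p = 0 := by
    have : P p.1 = .nil := (hPu p.1 .nil SimpleGraph.Walk.IsPath.nil).symm
    simp [hφ, this, routeLength]
  have h1 : φ q = routeLength T.glue w p.2 q.2 := by
    simp only [hφ]; rw [hPu q.1 w hw]
  rw [h0, h1, sub_zero, one_mul, treeDist_comm] at this
  exact (le_abs_self _).trans this

/-- Both distances are lengths of routes along the same path of `G`, which has fewer than `k` edges.
The bound is uniform in the two points. -/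
theorem abs_treeDist_sub_glue (hG : G.IsTree) (T' : TreeSystem d G) (p q : TreePoint k) :
    |treeDist T p q - treeDist T' p q| ≤ 2 * k * dist T.glue T'.glue := by
  obtain ⟨w, hw, -⟩ := hG.existsUnique_path p.1 q.1
  rw [treeDist_eq_routeLength T hG p q w hw, treeDist_eq_routeLength T' hG p q w hw]
  refine (abs_routeLength_sub_glue _ _ w _ _).trans ?_
  have : w.length < k := by simpa using hw.length_lt
  gcongr

theorem treeDist_le (hG : G.IsTree) (p q : TreePoint k) :
    treeDist T p q ≤ |p.2| + |q.2| + 2 * k * ∑ i, ∑ j, |T.glue i j| := by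
  obtain ⟨w, hw, -⟩ := hG.existsUnique_path p.1 q.1
  rw [treeDist_eq_routeLength T hG p q w hw]
  refine (routeLength_le _ w _ _).trans ?_
  have : w.length < k := by simpa using hw.length_lt
  gcongr

theorem continuous_treeDist (hG : G.IsTree) :
    Continuous fun x : TreePoint k × TreePoint k =>
    treeDist T x.1 x.2 := by
  have hdiag : ∀ i t u, treeDist T (i, t) (i, u) ≤ |t - u| := fun i t u =>
    treeDist_le_routeLength T (i, t) (i, u) .nil
  rw [continuous_iff_continuousAt]
  rintro ⟨⟨i, t⟩, ⟨j, u⟩⟩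
  have hbound : ∀ t' u', |treeDist T (i, t') (j, u') - treeDist T (i, t) (j, u)|
      ≤ |t' - t| + |u' - u| := by
    intro t' u'
    have h1 := treeDist_triangle T hG (i, t') (i, t) (j, u')
    have h2 := treeDist_triangle T hG (i, t) (j, u) (j, u')
    have h3 := treeDist_triangle T hG (i, t) (i, t') (j, u)
    have h4 := treeDist_triangle T hG (i, t') (j, u') (j, u)
    have := hdiag i t' t
    have := hdiag i t t'
    have := hdiag j u' u
    have := hdiag j u u'
    rw [abs_sub_comm t t'] at *
    rw [abs_sub_comm u u'] at *
    rw [abs_le]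
    constructor <;> linarith
  have hlim : Filter.Tendsto (fun x : TreePoint k × TreePoint k => |x.1.2 - t| + |x.2.2 - u|)
      (nhds ((i, t), (j, u))) (nhds 0) := by
    have : Continuous fun x : TreePoint k × TreePoint k => |x.1.2 - t| + |x.2.2 - u| := by fun_prop
    simpa using this.tendsto ((i, t), (j, u))
  rw [ContinuousAt, tendsto_iff_dist_tendsto_zero]
  refine squeeze_zero' (Filter.Eventually.of_forall fun _ => dist_nonneg) ?_ hlim
  -- The set of lines is discrete, so nearby points lie on the same lines.
  have hi : ∀ᶠ x : TreePoint k × TreePoint k in nhds ((i, t), (j, u)), x.1.1 = i ∧ x.2.1 = j := by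
    have h1 : ContinuousAt (fun x : TreePoint k × TreePoint k => (x.1.1, x.2.1)) ((i, t), (j, u)) :=
      by fun_prop
    have := h1.eventually (IsOpen.mem_nhds (isOpen_discrete {(i, j)}) rfl)
    filter_upwards [this] with x hx
    exact Prod.mk.inj (show (x.1.1, x.2.1) = (i, j) from hx)
  filter_upwards [hi] with x hx
  obtain ⟨⟨i', t'⟩, ⟨j', u'⟩⟩ := x
  obtain ⟨rfl, rfl⟩ := hx
  exact hbound t' u'

end TreeDist

/-! ### The order-one Wasserstein distance for a general cost. -/

section Wasserstein

variable {Ω : Type*} [MeasurableSpace Ω] {c : Ω → Ω → ℝ}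

theorem wasserstein_le {μ ν : Measure Ω} (π : Measure (Ω × Ω)) (h1 : π.map Prod.fst = μ)
    (h2 : π.map Prod.snd = ν) :
    wasserstein c μ ν ≤ ∫⁻ p, ENNReal.ofReal (c p.1 p.2) ∂π :=
  iInf_le_of_le π (iInf_le_of_le h1 (iInf_le_of_le h2 le_rfl))

theorem exists_coupling_lt {μ ν : Measure Ω} {b : ℝ≥0∞} (h : wasserstein c μ ν < b) :
    ∃ π : Measure (Ω × Ω), π.map Prod.fst = μ ∧ π.map Prod.snd = ν ∧
      ∫⁻ p, ENNReal.ofReal (c p.1 p.2) ∂π < b := by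
  simpa only [wasserstein, iInf_lt_iff, exists_prop] using h

theorem wasserstein_comm_le (hc : ∀ x y, c x y = c y x) (μ ν : Measure Ω) :
    wasserstein c μ ν ≤ wasserstein c ν μ := by
  refine le_iInf fun π => le_iInf fun h1 => le_iInf fun h2 => ?_
  refine (wasserstein_le (π.map Prod.swap) ?_ ?_).trans_eq ?_
  · rw [Measure.map_map measurable_fst measurable_swap]; exact h2
  · rw [Measure.map_map measurable_snd measurable_swap]; exact h1
  · rw [show (Prod.swap : Ω × Ω → Ω × Ω) = MeasurableEquiv.prodComm from rfl,
      lintegral_map_equiv]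
    simp only [MeasurableEquiv.prodComm, MeasurableEquiv.coe_mk, Equiv.prodComm_apply,
      Prod.fst_swap, Prod.snd_swap]
    exact lintegral_congr fun p => by rw [hc]

theorem wasserstein_comm (hc : ∀ x y, c x y = c y x) (μ ν : Measure Ω) :
    wasserstein c μ ν = wasserstein c ν μ :=
  le_antisymm (wasserstein_comm_le hc μ ν) (wasserstein_comm_le hc ν μ)

theorem wasserstein_self (hm : Measurable fun p : Ω × Ω => c p.1 p.2) (hc : ∀ x, c x x = 0)
    (μ : Measure Ω) : wasserstein c μ μ = 0 := by
  have hd : Measurable fun x : Ω => (x, x) := measurable_id.prodMk measurable_id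
  refine le_antisymm ((wasserstein_le (μ.map fun x => (x, x)) ?_ ?_).trans_eq ?_) zero_le
  · rw [Measure.map_map measurable_fst hd]; exact Measure.map_id
  · rw [Measure.map_map measurable_snd hd]; exact Measure.map_id
  · rw [lintegral_map hm.ennreal_ofReal hd]
    simp [hc]

open ProbabilityTheory in
-- Disintegrate `π'` over its first marginal `ν` and attach the conditional kernel to the second
-- coordinate of `π`.
theorem exists_glued_coupling [StandardBorelSpace Ω] [Nonempty Ω] {ν : Measure Ω}
    (π : Measure (Ω × Ω)) [IsFiniteMeasure π] (h2 : π.map Prod.snd = ν)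
    (π' : Measure (Ω × Ω)) [IsFiniteMeasure π'] (h1' : π'.map Prod.fst = ν) :
    ∃ γ : Measure ((Ω × Ω) × Ω), γ.map Prod.fst = π ∧ γ.map (fun x => (x.1.2, x.2)) = π' := by
  refine ⟨π ⊗ₘ (π'.condKernel.comap Prod.snd measurable_snd), ?_, ?_⟩
  · exact Measure.fst_compProd _ _
  · have hg : Measurable fun x : (Ω × Ω) × Ω => (x.1.2, x.2) := by fun_prop
    refine Measure.ext_of_lintegral _ fun f hf => ?_
    rw [lintegral_map hf hg,
      Measure.lintegral_compProd (f := fun x : (Ω × Ω) × Ω => f (x.1.2, x.2)) (hf.comp hg)]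
    have hd := π'.disintegrate π'.condKernel
    conv_rhs => rw [← hd, Measure.lintegral_compProd hf, Measure.fst, h1', ← h2]
    rw [lintegral_map (Measurable.lintegral_kernel_prod_right' hf) measurable_snd]
    rfl

theorem wasserstein_triangle [StandardBorelSpace Ω]
    (hm : Measurable fun p : Ω × Ω => c p.1 p.2) (h0 : ∀ x y, 0 ≤ c x y)
    (hc : ∀ x y z, c x z ≤ c x y + c y z) (μ ν ρ : Measure Ω) [IsProbabilityMeasure ν] :
    wasserstein c μ ρ ≤ wasserstein c μ ν + wasserstein c ν ρ := by
  have : Nonempty Ω := nonempty_of_isProbabilityMeasure ν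
  have fin : ∀ {f : Ω × Ω → Ω} {π : Measure (Ω × Ω)}, Measurable f → π.map f = ν →
      IsFiniteMeasure π := by
    intro f π hf h
    refine ⟨?_⟩
    have : π.map f Set.univ = 1 := by rw [h]; simp
    rw [Measure.map_apply hf .univ] at this
    simp [Set.preimage_univ ▸ this]
  conv_rhs => simp only [wasserstein, ENNReal.iInf_add, ENNReal.add_iInf]
  refine le_iInf fun π' => le_iInf fun h1' => le_iInf fun h2' => le_iInf fun π =>
    le_iInf fun h1 => le_iInf fun h2 => ?_
  have := fin measurable_snd h2
  have := fin measurable_fst h1'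
  obtain ⟨γ, hγ, hγ'⟩ := exists_glued_coupling π h2 π' h1'
  have hg : Measurable fun x : (Ω × Ω) × Ω => (x.1.2, x.2) := by fun_prop
  have hg' : Measurable fun x : (Ω × Ω) × Ω => (x.1.1, x.2) := by fun_prop
  refine (wasserstein_le (γ.map fun x => (x.1.1, x.2)) ?_ ?_).trans ?_
  · rw [← h1, ← hγ, Measure.map_map measurable_fst hg',
      Measure.map_map measurable_fst measurable_fst]
    rfl
  · rw [← h2', ← hγ', Measure.map_map measurable_snd hg', Measure.map_map measurable_snd hg]
    rfl
  · rw [← hγ, ← hγ', lintegral_map hm.ennreal_ofReal hg', lintegral_map hm.ennreal_ofReal hg,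
      lintegral_map hm.ennreal_ofReal measurable_fst,
      ← lintegral_add_left (f := fun x : (Ω × Ω) × Ω => ENNReal.ofReal (c x.1.1 x.1.2))
        (hm.ennreal_ofReal.comp measurable_fst)]
    refine lintegral_mono fun x => ?_
    rw [← ENNReal.ofReal_add (h0 _ _) (h0 _ _)]
    exact ENNReal.ofReal_le_ofReal (hc _ _ _)

theorem isProbabilityMeasure_of_map {α β : Type*} [MeasurableSpace α] [MeasurableSpace β]
    {π : Measure α} {f : α → β} (hf : Measurable f) [h : IsProbabilityMeasure (π.map f)] :
    IsProbabilityMeasure π :=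
  ⟨by simpa [Measure.map_apply hf .univ] using h.measure_univ⟩

/-- The easy half of Kantorovich duality, applied to couplings of arbitrarily small cost; no optimal
coupling is needed. -/
theorem integral_eq_of_wasserstein_eq_zero {μ ν : Measure Ω} [IsProbabilityMeasure μ]
    (h : wasserstein c μ ν = 0) {φ : Ω → ℝ} (hφ : Measurable φ) {M : ℝ}
    (hM : ∀ x, |φ x| ≤ M) {C : ℝ} (hC : 0 ≤ C) (hLip : ∀ x y, |φ x - φ y| ≤ C * c x y) :
    ∫ x, φ x ∂μ = ∫ x, φ x ∂ν := by
  have key : ∀ ε : ℝ≥0∞, 0 < ε →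
      ENNReal.ofReal |∫ x, φ x ∂μ - ∫ x, φ x ∂ν| ≤ ENNReal.ofReal C * ε := by
    intro ε hε
    obtain ⟨π, h1, h2, hlt⟩ := exists_coupling_lt (h.trans_lt hε)
    have : IsProbabilityMeasure (π.map Prod.fst) := h1 ▸ inferInstance
    have := isProbabilityMeasure_of_map (π := π) measurable_fst
    have hint : ∀ {f : Ω × Ω → Ω}, Measurable f → Integrable (fun p => φ (f p)) π := fun hf =>
      Integrable.of_bound (hφ.comp hf).aestronglyMeasurable M (.of_forall fun x => hM _)
    rw [← h1, ← h2, integral_map measurable_fst.aemeasurable hφ.aestronglyMeasurable,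
      integral_map measurable_snd.aemeasurable hφ.aestronglyMeasurable,
      ← integral_sub (hint measurable_fst) (hint measurable_snd)]
    calc ENNReal.ofReal |∫ p, (φ p.1 - φ p.2) ∂π|
        = ‖∫ p, (φ p.1 - φ p.2) ∂π‖ₑ := by
          rw [← Real.norm_eq_abs, ofReal_norm]
      _ ≤ ∫⁻ p, ‖φ p.1 - φ p.2‖ₑ ∂π := enorm_integral_le_lintegral_enorm _
      _ ≤ ∫⁻ p, ENNReal.ofReal C * ENNReal.ofReal (c p.1 p.2) ∂π := by
          refine lintegral_mono fun p => ?_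
          rw [← ENNReal.ofReal_mul hC, ← ofReal_norm, Real.norm_eq_abs]
          exact ENNReal.ofReal_le_ofReal (hLip _ _)
      _ = ENNReal.ofReal C * ∫⁻ p, ENNReal.ofReal (c p.1 p.2) ∂π :=
          lintegral_const_mul' _ _ ENNReal.ofReal_ne_top
      _ ≤ _ := by gcongr
  have hlim : Filter.Tendsto (fun ε : ℝ≥0∞ => ENNReal.ofReal C * ε) (nhdsWithin 0 (Set.Ioi 0))
      (nhds 0) := by
    have := ENNReal.Tendsto.const_mul (a := ENNReal.ofReal C) (b := 0) (f := nhds 0)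
      Filter.tendsto_id (Or.inr ENNReal.ofReal_ne_top)
    simpa using this.mono_left nhdsWithin_le_nhds
  have h0 := ge_of_tendsto hlim (Filter.eventually_of_mem self_mem_nhdsWithin key)
  have := ENNReal.ofReal_eq_zero.mp (le_antisymm h0 zero_le)
  exact sub_eq_zero.mp (abs_nonpos_iff.mp this)

/-- The product coupling suffices for costs dominated by a sum. -/
theorem wasserstein_le_add {μ ν : Measure Ω} [IsProbabilityMeasure μ] [IsProbabilityMeasure ν]
    {A B : Ω → ℝ} (hA : Measurable A) (hB : Measurable B) (hc : ∀ x y, c x y ≤ A x + B y) :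
    wasserstein c μ ν ≤ ∫⁻ x, ENNReal.ofReal (A x) ∂μ + ∫⁻ x, ENNReal.ofReal (B x) ∂ν := by
  refine (wasserstein_le (μ.prod ν) (by simp) (by simp)).trans ?_
  calc ∫⁻ p, ENNReal.ofReal (c p.1 p.2) ∂(μ.prod ν)
      ≤ ∫⁻ p, (ENNReal.ofReal (A p.1) + ENNReal.ofReal (B p.2)) ∂(μ.prod ν) :=
        lintegral_mono fun p => (ENNReal.ofReal_le_ofReal (hc _ _)).trans ENNReal.ofReal_add_le
    _ = ∫⁻ p, ENNReal.ofReal (A p.1) ∂(μ.prod ν) + ∫⁻ p, ENNReal.ofReal (B p.2) ∂(μ.prod ν) :=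
        lintegral_add_left (by fun_prop) _
    _ = _ := by
        rw [← lintegral_map (f := fun x => ENNReal.ofReal (A x)) hA.ennreal_ofReal measurable_fst,
          ← lintegral_map (f := fun x => ENNReal.ofReal (B x)) hB.ennreal_ofReal measurable_snd]
        simp

end Wasserstein

/-! ### Integration against the split measure. -/

section SplitAndProject

variable {X : Type*} [MeasurableSpace X] {k : ℕ} {a c : X → Fin k → ℝ} (μ : Measure X)

theorem lintegral_splitAndProject (ha : ∀ i, Measurable fun y => a y i)
    (hc : ∀ i, Measurable fun y => c y i) {f : TreePoint k → ℝ≥0∞} (hf : Measurable f) :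
    ∫⁻ p, f p ∂(splitAndProject a c μ)
      = ∑ i, ∫⁻ y, ENNReal.ofReal (a y i) * f (i, c y i) ∂μ := by
  have hg : ∀ i, Measurable fun y => ((i, c y i) : TreePoint k) := fun i =>
    measurable_const.prodMk (hc i)
  rw [splitAndProject, lintegral_finsetSum_measure]
  refine Finset.sum_congr rfl fun i _ => ?_
  rw [lintegral_map hf (hg i), lintegral_withDensity_eq_lintegral_mul (g := fun y => f (i, c y i)) _
    (ha i).ennreal_ofReal (hf.comp (hg i))]
  rfl

theorem isProbabilityMeasure_splitAndProject [IsProbabilityMeasure μ]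
    (ha : ∀ i, Measurable fun y => a y i) (hc : ∀ i, Measurable fun y => c y i)
    (h0 : ∀ y i, 0 ≤ a y i) (h1 : ∀ y, ∑ i, a y i = 1) :
    IsProbabilityMeasure (splitAndProject a c μ) := by
  constructor
  rw [← lintegral_one, lintegral_splitAndProject μ ha hc measurable_const]
  simp only [mul_one]
  rw [← lintegral_finsetSum _ fun i _ => (ha i).ennreal_ofReal]
  simp_rw [← ENNReal.ofReal_sum_of_nonneg fun i _ => h0 _ i, h1]
  simp

theorem integral_splitAndProject [IsProbabilityMeasure μ]
    (ha : ∀ i, Measurable fun y => a y i) (hc : ∀ i, Measurable fun y => c y i)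
    (h0 : ∀ y i, 0 ≤ a y i) (h1 : ∀ y, ∑ i, a y i = 1) {f : TreePoint k → ℝ}
    (hf : Measurable f) {M : ℝ} (hM : ∀ p, |f p| ≤ M) :
    ∫ p, f p ∂(splitAndProject a c μ) = ∑ i, ∫ y, a y i * f (i, c y i) ∂μ := by
  have hg : ∀ i, Measurable fun y => ((i, c y i) : TreePoint k) := fun i =>
    measurable_const.prodMk (hc i)
  have := isProbabilityMeasure_splitAndProject μ ha hc h0 h1
  have hint : Integrable f (splitAndProject a c μ) :=
    Integrable.of_bound hf.aestronglyMeasurable M (.of_forall hM)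
  rw [splitAndProject, integrable_finsetSum_measure] at hint
  rw [splitAndProject, integral_finsetSum_measure hint]
  refine Finset.sum_congr rfl fun i _ => ?_
  rw [integral_map (hg i).aemeasurable hf.aestronglyMeasurable,
    integral_withDensity_eq_integral_toReal_smul (ha i).ennreal_ofReal (by simp)]
  simp [ENNReal.toReal_ofReal (h0 _ _)]

end SplitAndProject

/-! ### Weak limits of couplings and lower semicontinuity of the transport cost. -/

theorem lintegral_le_liminf_of_tendsto {Ω : Type*} [MeasurableSpace Ω] [TopologicalSpace Ω]
    [OpensMeasurableSpace Ω] {π : ℕ → ProbabilityMeasure Ω} {π₀ : ProbabilityMeasure Ω}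
    (h : Tendsto π atTop (𝓝 π₀)) {f : Ω → ℝ} (hf : Continuous f) {b : ℝ≥0∞}
    {b' : ℕ → ℝ≥0∞} (hb' : Tendsto b' atTop (𝓝 b))
    (hb : ∀ n, ∫⁻ x, ENNReal.ofReal (f x) ∂(π n : Measure Ω) ≤ b' n) :
    ∫⁻ x, ENNReal.ofReal (f x) ∂(π₀ : Measure Ω) ≤ b := by
  -- Weak convergence only tests bounded functions, so the cost is truncated at `N`; monotone
  -- convergence removes the truncation.
  have hN : ∀ N : ℕ, ∫⁻ x, min (ENNReal.ofReal (f x)) N ∂(π₀ : Measure Ω) ≤ b := by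
    intro N
    let g : BoundedContinuousFunction Ω NNReal := BoundedContinuousFunction.mkOfBound
      ⟨fun x => min (Real.toNNReal (f x)) N, by fun_prop⟩ (N : ℝ) (by
        intro x y
        rw [NNReal.dist_eq, abs_le]
        have hx : ((min (Real.toNNReal (f x)) N : NNReal) : ℝ) ≤ N := by
          exact_mod_cast min_le_right _ _
        have hy : ((min (Real.toNNReal (f y)) N : NNReal) : ℝ) ≤ N := by
          exact_mod_cast min_le_right _ _
        have hx0 := (min (Real.toNNReal (f x)) N : NNReal).2
        have hy0 := (min (Real.toNNReal (f y)) N : NNReal).2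
        constructor
        · exact (by linarith : -(N : ℝ) ≤ ((min (Real.toNNReal (f x)) N : NNReal) : ℝ)
            - ((min (Real.toNNReal (f y)) N : NNReal) : ℝ))
        · exact (by linarith : ((min (Real.toNNReal (f x)) N : NNReal) : ℝ)
            - ((min (Real.toNNReal (f y)) N : NNReal) : ℝ) ≤ (N : ℝ)))
    have hg : ∀ x, (g x : ℝ≥0∞) = min (ENNReal.ofReal (f x)) N := by
      intro x
      change ((min (Real.toNNReal (f x)) N : NNReal) : ℝ≥0∞) = _
      rw [ENNReal.coe_min]; rfl
    have := (ProbabilityMeasure.tendsto_iff_forall_lintegral_tendsto.1 h) g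
    simp only [hg] at this
    refine le_of_tendsto_of_tendsto this hb' (.of_forall fun n => ?_)
    exact (lintegral_mono fun x => min_le_left _ _).trans (hb n)
  have hsup : ∀ x, ENNReal.ofReal (f x) = ⨆ N : ℕ, min (ENNReal.ofReal (f x)) N := by
    intro x
    refine le_antisymm ?_ (iSup_le fun N => min_le_left _ _)
    obtain ⟨N, hN⟩ := exists_nat_ge (f x)
    refine le_iSup_of_le N (le_min le_rfl ?_)
    simpa using ENNReal.ofReal_le_ofReal hN
  calc ∫⁻ x, ENNReal.ofReal (f x) ∂(π₀ : Measure Ω)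
      = ⨆ N : ℕ, ∫⁻ x, min (ENNReal.ofReal (f x)) N ∂(π₀ : Measure Ω) := by
        rw [← lintegral_iSup]
        · exact lintegral_congr hsup
        · intro N
          exact (hf.measurable.ennreal_ofReal).min measurable_const
        · intro N N' h x
          exact min_le_min le_rfl (by exact_mod_cast h)
    _ ≤ b := iSup_le hN

section Compactness

variable {Ω : Type*} [MeasurableSpace Ω] [TopologicalSpace Ω] [BorelSpace Ω] [PolishSpace Ω]

theorem isTightMeasureSet_range_of_tendsto {m : ℕ → ProbabilityMeasure Ω}
    {m₀ : ProbabilityMeasure Ω} (h : Tendsto m atTop (𝓝 m₀)) :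
    IsTightMeasureSet {(μ : Measure Ω) | μ ∈ Set.range m} := by
  let _ := TopologicalSpace.upgradeIsCompletelyMetrizable Ω
  refine isTightMeasureSet_of_isCompact_closure ?_
  exact h.isCompact_insert_range.closure_of_subset (Set.subset_insert _ _)

/-- Couplings of convergent marginals subconverge to a coupling of the limits. -/
theorem exists_subseq_tendsto_coupling {m m' : ℕ → ProbabilityMeasure Ω}
    {m₀ m₀' : ProbabilityMeasure Ω} (h : Tendsto m atTop (𝓝 m₀)) (h' : Tendsto m' atTop (𝓝 m₀'))
    (π : ℕ → ProbabilityMeasure (Ω × Ω))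
    (h1 : ∀ n, (π n : Measure (Ω × Ω)).map Prod.fst = m n)
    (h2 : ∀ n, (π n : Measure (Ω × Ω)).map Prod.snd = m' n) :
    ∃ (π₀ : ProbabilityMeasure (Ω × Ω)) (φ : ℕ → ℕ), StrictMono φ ∧
      Tendsto (π ∘ φ) atTop (𝓝 π₀) ∧ (π₀ : Measure (Ω × Ω)).map Prod.fst = m₀ ∧
      (π₀ : Measure (Ω × Ω)).map Prod.snd = m₀' := by
  -- Tight marginals force tight couplings: outside `K ×ˢ K'` one of the two coordinates leaves its
  -- compact set.
  have htight : IsTightMeasureSet {(μ : Measure (Ω × Ω)) | μ ∈ Set.range π} := by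
    rw [isTightMeasureSet_iff_exists_isCompact_measure_compl_le]
    intro ε hε
    have hε2 : 0 < ε / 2 := ENNReal.half_pos hε.ne'
    obtain ⟨K, hK, hKm⟩ := isTightMeasureSet_iff_exists_isCompact_measure_compl_le.1
      (isTightMeasureSet_range_of_tendsto h) _ hε2
    obtain ⟨K', hK', hKm'⟩ := isTightMeasureSet_iff_exists_isCompact_measure_compl_le.1
      (isTightMeasureSet_range_of_tendsto h') _ hε2
    refine ⟨K ×ˢ K', hK.prod hK', ?_⟩
    rintro _ ⟨_, ⟨n, rfl⟩, rfl⟩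
    have hsub : (K ×ˢ K')ᶜ ⊆ Prod.fst ⁻¹' Kᶜ ∪ Prod.snd ⁻¹' K'ᶜ := by
      rintro ⟨x, y⟩ hxy
      simp only [Set.mem_compl_iff, Set.mem_prod, not_and_or] at hxy
      exact hxy
    calc (π n : Measure (Ω × Ω)) (K ×ˢ K')ᶜ
        ≤ (π n : Measure (Ω × Ω)) (Prod.fst ⁻¹' Kᶜ) + (π n : Measure (Ω × Ω)) (Prod.snd ⁻¹' K'ᶜ) :=
          (measure_mono hsub).trans (measure_union_le _ _)
      _ ≤ ε / 2 + ε / 2 := by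
          gcongr
          · rw [← Measure.map_apply measurable_fst hK.isClosed.measurableSet.compl, h1]
            exact hKm _ ⟨_, ⟨n, rfl⟩, rfl⟩
          · rw [← Measure.map_apply measurable_snd hK'.isClosed.measurableSet.compl, h2]
            exact hKm' _ ⟨_, ⟨n, rfl⟩, rfl⟩
      _ = ε := ENNReal.add_halves ε
  have hcomp := isCompact_closure_of_isTightMeasureSet htight
  let _ := TopologicalSpace.upgradeIsCompletelyMetrizable Ω
  obtain ⟨π₀, -, φ, hφ, hlim⟩ := hcomp.isSeqCompact (x := π) fun n => subset_closure ⟨n, rfl⟩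
  refine ⟨π₀, φ, hφ, hlim, ?_, ?_⟩
  · have e1 := ((ProbabilityMeasure.continuous_map continuous_fst).tendsto π₀).comp hlim
    have e2 := h.comp hφ.tendsto_atTop
    have : (fun μ : ProbabilityMeasure (Ω × Ω) => μ.map continuous_fst.aemeasurable) ∘ (π ∘ φ)
        = m ∘ φ := by
      funext n; exact Subtype.ext (h1 _)
    rw [this] at e1
    exact congrArg ProbabilityMeasure.toMeasure (tendsto_nhds_unique e1 e2)
  · have e1 := ((ProbabilityMeasure.continuous_map continuous_snd).tendsto π₀).comp hlim
    have e2 := h'.comp hφ.tendsto_atTop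
    have : (fun μ : ProbabilityMeasure (Ω × Ω) => μ.map continuous_snd.aemeasurable) ∘ (π ∘ φ)
        = m' ∘ φ := by
      funext n; exact Subtype.ext (h2 _)
    rw [this] at e1
    exact congrArg ProbabilityMeasure.toMeasure (tendsto_nhds_unique e1 e2)

/-- The Wasserstein distance is sequentially lower semicontinuous along uniformly convergent
costs and weakly convergent marginals. -/
theorem wasserstein_le_of_tendsto {c : ℕ → Ω → Ω → ℝ} {c₀ : Ω → Ω → ℝ}
    (hc : Continuous fun p : Ω × Ω => c₀ p.1 p.2) {δ : ℕ → ℝ} (hδ : Tendsto δ atTop (𝓝 0))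
    (hcδ : ∀ n x y, c₀ x y ≤ c n x y + δ n)
    {m m' : ℕ → ProbabilityMeasure Ω}
    {m₀ m₀' : ProbabilityMeasure Ω} (h : Tendsto m atTop (𝓝 m₀)) (h' : Tendsto m' atTop (𝓝 m₀'))
    {b : ℝ≥0∞} (hb : ∀ n, wasserstein (c n) (m n : Measure Ω) (m' n) ≤ b) :
    wasserstein c₀ (m₀ : Measure Ω) m₀' ≤ b := by
  rcases eq_or_ne b ∞ with rfl | hb_top
  · exact le_top
  -- A slack of `1 / (n + 1)` provides almost optimal couplings and disappears in the limit.
  have hpos : ∀ n : ℕ, (0 : ℝ≥0∞) < ENNReal.ofReal (1 / ((n : ℝ) + 1)) := fun n => by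
    rw [ENNReal.ofReal_pos]; positivity
  have hlt : ∀ n : ℕ, wasserstein (c n) (m n : Measure Ω) (m' n)
      < b + ENNReal.ofReal (1 / ((n : ℝ) + 1)) := fun n =>
    (hb n).trans_lt (ENNReal.lt_add_right hb_top (hpos n).ne')
  choose π h1 h2 h3 using fun n => exists_coupling_lt (hlt n)
  have hprob : ∀ n, IsProbabilityMeasure (π n) := fun n => by
    have : IsProbabilityMeasure ((π n).map Prod.fst) := h1 n ▸ inferInstance
    exact isProbabilityMeasure_of_map measurable_fst
  obtain ⟨π₀, φ, hφ, hlim, e1, e2⟩ := exists_subseq_tendsto_coupling h h'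
    (fun n => ⟨π n, hprob n⟩) h1 h2
  refine (wasserstein_le _ e1 e2).trans ?_
  have hb' : Tendsto (fun n : ℕ => b + ENNReal.ofReal (1 / ((n : ℝ) + 1)) + ENNReal.ofReal (δ n))
      atTop (𝓝 b) := by
    have t1 := ENNReal.tendsto_ofReal tendsto_one_div_add_atTop_nhds_zero_nat
    have t2 := ENNReal.tendsto_ofReal hδ
    simpa using (tendsto_const_nhds (x := b)).add t1 |>.add t2
  refine lintegral_le_liminf_of_tendsto hlim hc (hb'.comp hφ.tendsto_atTop) fun n => ?_
  have := hprob (φ n)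
  calc ∫⁻ x, ENNReal.ofReal (c₀ x.1 x.2) ∂(π (φ n))
      ≤ ∫⁻ x, (ENNReal.ofReal (c (φ n) x.1 x.2) + ENNReal.ofReal (δ (φ n))) ∂(π (φ n)) :=
        lintegral_mono fun x => (ENNReal.ofReal_le_ofReal (hcδ _ _ _)).trans ENNReal.ofReal_add_le
    _ = ∫⁻ x, ENNReal.ofReal (c (φ n) x.1 x.2) ∂(π (φ n)) + ENNReal.ofReal (δ (φ n)) := by
        rw [lintegral_add_right _ measurable_const]; simp
    _ ≤ _ := by
        simp only [Function.comp]
        gcongr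
        exact (h3 _).le

end Compactness

/-! ### Weak continuity of the transforms. -/

section Transforms

variable {X : Type*} [MeasurableSpace X] {k : ℕ}

/-- The split measure as a probability measure. -/
def splitProb (μ : ProbabilityMeasure X) {a c : X → Fin k → ℝ}
    (ha : ∀ i, Measurable fun y => a y i) (hc : ∀ i, Measurable fun y => c y i)
    (h0 : ∀ y i, 0 ≤ a y i) (h1 : ∀ y, ∑ i, a y i = 1) : ProbabilityMeasure (TreePoint k) :=
  ⟨splitAndProject a c μ, isProbabilityMeasure_splitAndProject _ ha hc h0 h1⟩

theorem le_one_of_sum_eq_one {f : Fin k → ℝ} (h0 : ∀ i, 0 ≤ f i) (h1 : ∑ i, f i = 1) (i : Fin k) :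
    f i ≤ 1 :=
  h1 ▸ Finset.single_le_sum (f := f) (fun i _ => h0 i) (Finset.mem_univ i)

theorem tendsto_splitProb (μ : ProbabilityMeasure X) {a c : ℕ → X → Fin k → ℝ}
    {a₀ c₀ : X → Fin k → ℝ}
    (ha : ∀ n i, Measurable fun y => a n y i) (hc : ∀ n i, Measurable fun y => c n y i)
    (h0 : ∀ n y i, 0 ≤ a n y i) (h1 : ∀ n y, ∑ i, a n y i = 1)
    (ha₀ : ∀ i, Measurable fun y => a₀ y i) (hc₀ : ∀ i, Measurable fun y => c₀ y i)
    (h0₀ : ∀ y i, 0 ≤ a₀ y i) (h1₀ : ∀ y, ∑ i, a₀ y i = 1)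
    (hlima : ∀ y i, Tendsto (fun n => a n y i) atTop (𝓝 (a₀ y i)))
    (hlimc : ∀ y i, Tendsto (fun n => c n y i) atTop (𝓝 (c₀ y i))) :
    Tendsto (fun n => splitProb μ (ha n) (hc n) (h0 n) (h1 n)) atTop
      (𝓝 (splitProb μ ha₀ hc₀ h0₀ h1₀)) := by
  rw [ProbabilityMeasure.tendsto_iff_forall_integral_tendsto]
  intro f
  have hM : ∀ p, |f p| ≤ ‖f‖ := fun p => f.norm_coe_le_norm p
  have e : ∀ {a c : X → Fin k → ℝ} (ha : ∀ i, Measurable fun y => a y i)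
      (hc : ∀ i, Measurable fun y => c y i) (h0 : ∀ y i, 0 ≤ a y i) (h1 : ∀ y, ∑ i, a y i = 1),
      ∫ p, f p ∂(splitProb μ ha hc h0 h1 : Measure (TreePoint k))
        = ∑ i, ∫ y, a y i * f (i, c y i) ∂(μ : Measure X) := fun ha hc h0 h1 =>
    integral_splitAndProject _ ha hc h0 h1 f.continuous.measurable hM
  simp only [e]
  refine tendsto_finsetSum _ fun i _ => ?_
  refine tendsto_integral_of_dominated_convergence (fun _ => ‖f‖) (fun n => ?_)
    (integrable_const _) (fun n => .of_forall fun y => ?_) (.of_forall fun y => ?_)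
  · exact ((ha n i).mul (f.continuous.measurable.comp
      (measurable_const.prodMk (hc n i)))).aestronglyMeasurable
  · rw [Real.norm_eq_abs, abs_mul, abs_of_nonneg (h0 n y i)]
    calc a n y i * |f (i, c n y i)| ≤ 1 * ‖f‖ :=
          mul_le_mul (le_one_of_sum_eq_one (h0 n y) (h1 n y) i) (hM _) (abs_nonneg _) zero_le_one
      _ = ‖f‖ := one_mul _
  · refine (hlima y i).mul ((f.continuous.tendsto _).comp ?_)
    exact tendsto_const_nhds.prodMk_nhds (hlimc y i)

end Transforms

/-! ### Measurability of the Wasserstein distance in the tree. -/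

section Measurability

variable {X : Type*} [TopologicalSpace X] [MeasurableSpace X] [OpensMeasurableSpace X]
  {d k : ℕ} {G : SimpleGraph (Fin k)}

theorem continuous_lines : Continuous (TreeSystem.lines : TreeSystem d G → LineSystem d k) :=
  continuous_fst.comp continuous_subtype_val

theorem continuous_glue : Continuous (TreeSystem.glue : TreeSystem d G → Fin k → Fin k → ℝ) :=
  continuous_snd.comp continuous_subtype_val

theorem lowerSemicontinuous_wasserstein_treeDist (hG : G.IsTree)
    {a c : X → LineSystem d k → Fin k → ℝ}
    (ha : ∀ i, Continuous fun p : X × LineSystem d k => a p.1 p.2 i)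
    (hc : ∀ i, Continuous fun p : X × LineSystem d k => c p.1 p.2 i)
    (h0 : ∀ y L i, 0 ≤ a y L i) (h1 : ∀ y L, ∑ i, a y L i = 1)
    (μ ν : ProbabilityMeasure X) :
    LowerSemicontinuous fun T : TreeSystem d G => wasserstein (treeDist T)
      (splitAndProject (a · T.lines) (c · T.lines) (μ : Measure X))
      (splitAndProject (a · T.lines) (c · T.lines) (ν : Measure X)) := by
  rw [lowerSemicontinuous_iff_isClosed_preimage]
  intro b
  refine IsSeqClosed.isClosed fun T T₀ hT hlim => ?_
  have hm : ∀ {f : X → LineSystem d k → Fin k → ℝ},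
      (∀ i, Continuous fun p : X × LineSystem d k => f p.1 p.2 i) →
      ∀ L i, Measurable fun y => f y L i := fun hf L i =>
    ((hf i).comp (continuous_id.prodMk continuous_const)).measurable
  have hl : ∀ {f : X → LineSystem d k → Fin k → ℝ},
      (∀ i, Continuous fun p : X × LineSystem d k => f p.1 p.2 i) →
      ∀ y i, Tendsto (fun n => f y (T n).lines i) atTop (𝓝 (f y T₀.lines i)) := fun hf y i =>
    (((hf i).comp (continuous_const.prodMk continuous_lines)).tendsto T₀).comp hlim
  have ht := fun κ : ProbabilityMeasure X => tendsto_splitProb κ (fun n => hm ha (T n).lines)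
    (fun n => hm hc (T n).lines) (fun n y => h0 y _) (fun n y => h1 y _)
    (hm ha T₀.lines) (hm hc T₀.lines) (fun y => h0 y _) (fun y => h1 y _) (hl ha) (hl hc)
  refine wasserstein_le_of_tendsto (c := fun n => treeDist (T n)) (c₀ := treeDist T₀)
    (continuous_treeDist T₀ hG) (δ := fun n => 2 * k * dist (T₀.glue) (T n).glue) ?_ ?_
    (ht μ) (ht ν) hT
  · have : Tendsto (fun n => (T n).glue) atTop (𝓝 T₀.glue) :=
      (continuous_glue.tendsto T₀).comp hlim
    have := (tendsto_const_nhds (x := T₀.glue)).dist this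
    simpa using this.const_mul (2 * k : ℝ)
  · intro n p q
    have := (abs_le.1 (abs_treeDist_sub_glue T₀ hG (T n) p q)).2
    linarith

theorem measurable_wasserstein_treeDist (hG : G.IsTree)
    {a c : X → LineSystem d k → Fin k → ℝ}
    (ha : ∀ i, Continuous fun p : X × LineSystem d k => a p.1 p.2 i)
    (hc : ∀ i, Continuous fun p : X × LineSystem d k => c p.1 p.2 i)
    (h0 : ∀ y L i, 0 ≤ a y L i) (h1 : ∀ y L, ∑ i, a y L i = 1)
    (μ ν : ProbabilityMeasure X) :
    Measurable fun T : TreeSystem d G => wasserstein (treeDist T)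
      (splitAndProject (a · T.lines) (c · T.lines) (μ : Measure X))
      (splitAndProject (a · T.lines) (c · T.lines) (ν : Measure X)) :=
  (lowerSemicontinuous_wasserstein_treeDist hG ha hc h0 h1 μ ν).measurable

end Measurability

/-! ### Measures determined by translates of one function. -/

section CharacteristicFunctions

open Complex

section SlowWeight

variable {V : Type*} [NormedAddCommGroup V] [InnerProductSpace ℝ V]

theorem continuous_charFun_of_isFiniteMeasure [MeasurableSpace V] [BorelSpace V]
    (μ : Measure V) [IsFiniteMeasure μ] :
    Continuous (charFun μ) := by
  refine continuous_of_dominated (bound := fun _ => 1) (fun t => ?_) (fun t => ?_)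
    (integrable_const _) (.of_forall fun x => ?_)
  · exact (by fun_prop : Continuous fun x : V => cexp (⟪x, t⟫_ℝ * I)).aestronglyMeasurable
  · exact .of_forall fun x => (norm_exp_ofReal_mul_I _).le
  · fun_prop

/-- A weight that decays polynomially and varies slowly for small `ε`. -/
def slowWeight (ε : ℝ) (z : V) : ℝ := ((1 + ε * ‖z‖) ^ (Module.finrank ℝ V + 1))⁻¹

theorem slowWeight_pos {ε : ℝ} (hε : 0 ≤ ε) (z : V) : 0 < slowWeight ε z := by
  unfold slowWeight; positivity

theorem continuous_slowWeight {ε : ℝ} (hε : 0 ≤ ε) : Continuous (slowWeight ε : V → ℝ) := by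
  unfold slowWeight
  refine Continuous.inv₀ (by fun_prop) fun z => by positivity

/-- From `1 + ε‖x - y‖ ≤ (1 + ε‖y‖)(1 + ε‖x‖)`. A translation by `y` thus changes the weight by at
most the factor `slowWeight ε y`, which tends to 1 as `ε` tends to 0. -/
theorem slowWeight_mul_le {ε : ℝ} (hε : 0 ≤ ε) (x y : V) :
    slowWeight ε y * slowWeight ε x ≤ slowWeight ε (x - y) := by
  unfold slowWeight
  rw [← mul_inv, ← mul_pow]
  have h1 := norm_sub_le x y
  have h2 : 1 + ε * ‖x - y‖ ≤ (1 + ε * ‖y‖) * (1 + ε * ‖x‖) := by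
    have : 0 ≤ (ε * ‖y‖) * (ε * ‖x‖) := by positivity
    nlinarith [mul_le_mul_of_nonneg_left h1 hε]
  have h3 : 0 < 1 + ε * ‖x - y‖ := by positivity
  gcongr

end SlowWeight

section Uniqueness

variable {V : Type*} [NormedAddCommGroup V] [InnerProductSpace ℝ V] [FiniteDimensional ℝ V]
  [MeasurableSpace V] [BorelSpace V]

/-- If all translates of `g` have the same integral against `μ` and `ν`, then so does any
weighted integral of the translates. -/
theorem integral_integral_translate_eq {μ ν : Measure V} [IsProbabilityMeasure μ]
    [IsProbabilityMeasure ν] {g W : V → ℂ}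
    (hμ : Integrable (fun p : V × V => g (p.1 + p.2) * W p.2) (μ.prod volume))
    (hν : Integrable (fun p : V × V => g (p.1 + p.2) * W p.2) (ν.prod volume))
    (h : ∀ z, ∫ y, g (y + z) ∂μ = ∫ y, g (y + z) ∂ν) :
    ∫ y, (∫ z, g (y + z) * W z) ∂μ = ∫ y, (∫ z, g (y + z) * W z) ∂ν := by
  rw [integral_integral_swap (f := fun y z => g (y + z) * W z) hμ,
    integral_integral_swap (f := fun y z => g (y + z) * W z) hν]
  simp only [integral_mul_const, h]

theorem integrableExpSet_withDensity_eq_univ {F : V → ℝ} (hF : Continuous F)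
    (hF0 : ∀ u, 0 ≤ F u) (hFc : HasCompactSupport F) (X : V → ℝ) (hX : Continuous X) :
    ProbabilityTheory.integrableExpSet X (volume.withDensity fun u => ENNReal.ofReal (F u))
      = Set.univ := by
  refine Set.eq_univ_of_forall fun t => ?_
  change Integrable _ _
  rw [integrable_withDensity_iff_integrable_smul' (by fun_prop) (by simp)]
  simp only [ENNReal.toReal_ofReal (hF0 _), smul_eq_mul]
  exact (Continuous.integrable_of_hasCompactSupport (by fun_prop) hFc.mul_right)

/-- A finite measure is determined by its convolution with a compactly supported bump. -/
theorem eq_of_forall_integral_translate_eq {μ ν : Measure V} [IsProbabilityMeasure μ]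
    [IsProbabilityMeasure ν] {F : V → ℝ} (hF : Continuous F) (hF0 : ∀ u, 0 ≤ F u)
    (hFc : HasCompactSupport F) (hpos : ∃ u, 0 < F u)
    (h : ∀ z, ∫ y, F (y + z) ∂μ = ∫ y, F (y + z) ∂ν) : μ = ν := by
  have hFi : Integrable F := hF.integrable_of_hasCompactSupport hFc
  -- The Fourier transform of `F`. Integrating the hypothesis against a character in `z` factors
  -- each side into `charFun` times `D`.
  set D : V → ℂ := fun ξ => ∫ u, (F u : ℂ) * cexp (-⟪u, ξ⟫_ℝ * I) with hD
  have hmul : ∀ (κ : Measure V) [IsProbabilityMeasure κ] (ξ : V),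
      Integrable (fun p : V × V => (F (p.1 + p.2) : ℂ) * cexp (-⟪p.2, ξ⟫_ℝ * I)) (κ.prod volume) ∧
      ∫ y, (∫ z, (F (y + z) : ℂ) * cexp (-⟪z, ξ⟫_ℝ * I)) ∂κ = charFun κ ξ * D ξ := by
    intro κ _ ξ
    have hnorm : ∀ x : ℝ, ‖cexp (-x * I)‖ = 1 := fun x => by
      rw [← ofReal_neg]; exact norm_exp_ofReal_mul_I _
    constructor
    · rw [integrable_prod_iff (by
        exact (by fun_prop : Continuous fun p : V × V =>
          (F (p.1 + p.2) : ℂ) * cexp (-⟪p.2, ξ⟫_ℝ * I)).aestronglyMeasurable)]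
      refine ⟨.of_forall fun y => ?_, ?_⟩
      · refine Integrable.mono' (g := fun z => |F (y + z)|) ?_ ?_ (.of_forall fun z => ?_)
        · exact (hFi.comp_add_left y).abs
        · exact (by fun_prop : Continuous fun z : V =>
            (F (y + z) : ℂ) * cexp (-⟪z, ξ⟫_ℝ * I)).aestronglyMeasurable
        · rw [norm_mul, hnorm, mul_one, norm_real, Real.norm_eq_abs]
      · simp only [norm_mul, hnorm, mul_one, norm_real]
        have : ∀ y : V, ∫ z, ‖F (y + z)‖ = ∫ z, ‖F z‖ := fun y =>
          integral_add_left_eq_self (fun z => ‖F z‖) y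
        simp only [this]
        exact integrable_const _
    · rw [charFun_apply, ← integral_mul_const]
      refine integral_congr_ae (.of_forall fun y => ?_)
      simp only [hD]
      rw [← integral_const_mul, ← integral_add_left_eq_self
        (fun u => cexp (⟪y, ξ⟫_ℝ * I) * ((F u : ℂ) * cexp (-⟪u, ξ⟫_ℝ * I))) y]
      refine integral_congr_ae (.of_forall fun z => ?_)
      simp only [inner_add_left]
      rw [mul_left_comm, ← Complex.exp_add]
      congr 2
      push_cast; ring
  have hprod : ∀ ξ, charFun μ ξ * D ξ = charFun ν ξ * D ξ := by
    intro ξ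
    rw [← (hmul μ ξ).2, ← (hmul ν ξ).2]
    refine integral_integral_translate_eq (g := fun u => (F u : ℂ))
      (W := fun z => cexp (-⟪z, ξ⟫_ℝ * I)) (hmul μ ξ).1 (hmul ν ξ).1 fun z => ?_
    simp only [integral_complex_ofReal, h]
  refine Measure.ext_of_charFun (funext fun ξ => ?_)
  -- Along the line through `ξ`, `D` is the restriction to the imaginary axis of an entire function
  -- `Z` with `Z 0 = ∫ F > 0`. Its zeros are isolated, so `D` can be cancelled at `t • ξ` for `t ≠
  -- 1` near 1, and continuity gives `t = 1`.
  set ρ : Measure V := volume.withDensity fun u => ENNReal.ofReal (F u)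
  set X : V → ℝ := fun u => -⟪u, ξ⟫_ℝ
  have hX : Continuous X := by fun_prop
  have hset := integrableExpSet_withDensity_eq_univ hF hF0 hFc X hX
  set Z := ProbabilityTheory.complexMGF X ρ with hZ
  have hZa : AnalyticOnNhd ℂ Z Set.univ := by
    have := ProbabilityTheory.analyticOnNhd_complexMGF (X := X) (μ := ρ)
    rw [hset] at this
    simpa using this
  have hZint : ∀ z : ℂ, Z z = ∫ u, (F u : ℂ) * cexp (z * X u) := by
    intro z
    change ∫ u, cexp (z * X u) ∂ρ = _
    rw [integral_withDensity_eq_integral_toReal_smul (by fun_prop) (by simp)]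
    simp [ENNReal.toReal_ofReal (hF0 _)]
  have hZD : ∀ t : ℝ, D (t • ξ) = Z (t * I) := by
    intro t
    rw [hZint]
    refine integral_congr_ae (.of_forall fun u => ?_)
    simp only [X, real_inner_smul_right]
    congr 2
    push_cast; ring
  have hZ0 : Z 0 ≠ 0 := by
    rw [hZint]
    simp only [zero_mul, Complex.exp_zero, mul_one, integral_complex_ofReal, ne_eq, ofReal_eq_zero]
    obtain ⟨u, hu⟩ := hpos
    exact (hF.integral_pos_of_hasCompactSupport_nonneg_nonzero hFc hF0 hu.ne').ne'
  have hne : ∀ᶠ z in 𝓝[≠] I, Z z ≠ 0 := by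
    by_contra hcon
    have := hZa.eqOn_zero_of_preconnected_of_frequently_eq_zero isPreconnected_univ
      (Set.mem_univ I) ((not_eventually.1 hcon).mono fun z hz => not_not.1 hz)
    exact hZ0 (this (Set.mem_univ 0))
  have hne' : ∀ᶠ t : ℝ in 𝓝[≠] 1, Z (t * I) ≠ 0 := by
    have ht : Tendsto (fun t : ℝ => (t : ℂ) * I) (𝓝[≠] 1) (𝓝[≠] I) := by
      refine tendsto_nhdsWithin_iff.2 ⟨?_, ?_⟩
      · have : Continuous fun t : ℝ => (t : ℂ) * I := by fun_prop
        simpa using (this.tendsto 1).mono_left nhdsWithin_le_nhds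
      · filter_upwards [self_mem_nhdsWithin] with t ht
        have : (t : ℂ) ≠ 1 := by exact_mod_cast ht
        simpa using this
    exact ht.eventually hne
  have hlim : ∀ (κ : Measure V) [IsProbabilityMeasure κ],
      Tendsto (fun t : ℝ => charFun κ (t • ξ)) (𝓝[≠] 1) (𝓝 (charFun κ ξ)) := by
    intro κ _
    have : Continuous fun t : ℝ => charFun κ (t • ξ) :=
      (continuous_charFun_of_isFiniteMeasure κ).comp (by fun_prop)
    simpa using (this.tendsto 1).mono_left nhdsWithin_le_nhds
  refine tendsto_nhds_unique_of_eventuallyEq (hlim μ) (hlim ν) ?_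
  filter_upwards [hne'] with t ht
  have := hprod (t • ξ)
  rw [hZD] at this
  exact mul_right_cancel₀ ht this

theorem integrable_slowWeight {ε : ℝ} (hε : 0 < ε) (hε1 : ε ≤ 1) :
    Integrable (slowWeight ε : V → ℝ) := by
  have h := integrable_one_add_norm (E := V) (μ := volume)
    (r := (Module.finrank ℝ V + 1 : ℕ)) (by push_cast; linarith)
  refine (h.const_mul ((ε ^ (Module.finrank ℝ V + 1))⁻¹)).mono'
    (continuous_slowWeight hε.le).aestronglyMeasurable (.of_forall fun z => ?_)
  rw [Real.norm_of_nonneg (slowWeight_pos hε.le z).le, Real.rpow_neg (by positivity),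
    Real.rpow_natCast, ← mul_inv, ← mul_pow]
  unfold slowWeight
  have : ε * (1 + ‖z‖) ≤ 1 + ε * ‖z‖ := by linarith
  gcongr

/-- A probability measure is determined at the frequency `ξ` by the integrals of the translates of a
nonnegative bounded function modulated at this frequency. -/
theorem charFun_eq_of_forall_integral_modulated_eq {μ ν : Measure V} [IsProbabilityMeasure μ]
    [IsProbabilityMeasure ν] {F : V → ℝ} (hF : Continuous F) (hF0 : ∀ u, 0 ≤ F u) {M : ℝ}
    (hFM : ∀ u, F u ≤ M) (hpos : ∃ u, 0 < F u) (ξ : V)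
    (h : ∀ z, ∫ y, (F (y + z) : ℂ) * cexp (⟪y + z, ξ⟫_ℝ * I) ∂μ
      = ∫ y, (F (y + z) : ℂ) * cexp (⟪y + z, ξ⟫_ℝ * I) ∂ν) :
    charFun μ ξ = charFun ν ξ := by
  -- The average of `F` with the slow weight centred at `v`; it stays finite although `F` itself
  -- need not be integrable.
  set B : ℝ → V → ℝ := fun ε v => ∫ u, F u * slowWeight ε (u - v) with hB
  have hM : 0 ≤ M := (hF0 0).trans (hFM 0)
  have hint : ∀ {ε : ℝ}, 0 < ε → ε ≤ 1 → ∀ v, Integrable fun u => F u * slowWeight ε (u - v) := by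
    intro ε h0 h1 v
    refine (((integrable_slowWeight h0 h1).comp_sub_right v).const_mul M).mono' ?_
      (.of_forall fun u => ?_)
    · exact (hF.mul ((continuous_slowWeight h0.le).comp (by fun_prop))).aestronglyMeasurable
    · rw [Real.norm_of_nonneg (mul_nonneg (hF0 _) (slowWeight_pos h0.le _).le)]
      exact mul_le_mul_of_nonneg_right (hFM _) (slowWeight_pos h0.le _).le
  have hBpos : ∀ {ε : ℝ}, 0 < ε → ε ≤ 1 → ∀ v, 0 < B ε v := by
    intro ε h0 h1 v
    refine (integral_pos_iff_support_of_nonneg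
      (fun u => mul_nonneg (hF0 _) (slowWeight_pos h0.le _).le) (hint h0 h1 v)).2 ?_
    have hc : Continuous fun u => F u * slowWeight ε (u - v) :=
      hF.mul ((continuous_slowWeight h0.le).comp (by fun_prop))
    obtain ⟨u, hu⟩ := hpos
    exact hc.isOpen_support.measure_pos _ ⟨u, (mul_pos hu (slowWeight_pos h0.le _)).ne'⟩
  have hBle : ∀ {ε : ℝ}, 0 < ε → ε ≤ 1 → ∀ v, B ε v ≤ M * ∫ u : V, slowWeight ε u := by
    intro ε h0 h1 v
    rw [← integral_sub_right_eq_self _ v, ← integral_const_mul]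
    refine integral_mono (hint h0 h1 v)
      (((integrable_slowWeight h0 h1).comp_sub_right v).const_mul M) fun u => ?_
    exact mul_le_mul_of_nonneg_right (hFM _) (slowWeight_pos h0.le _).le
  have hBmul : ∀ {ε : ℝ}, 0 < ε → ε ≤ 1 → ∀ v y, slowWeight ε y * B ε v ≤ B ε (v + y) := by
    intro ε h0 h1 v y
    simp only [hB]
    rw [← integral_const_mul]
    refine integral_mono ((hint h0 h1 v).const_mul _) (hint h0 h1 _) fun u => ?_
    have := slowWeight_mul_le h0.le (u - v) y
    rw [sub_sub] at this
    calc slowWeight ε y * (F u * slowWeight ε (u - v))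
        = F u * (slowWeight ε y * slowWeight ε (u - v)) := by ring
      _ ≤ F u * slowWeight ε (u - (v + y)) := mul_le_mul_of_nonneg_left this (hF0 u)
  have hBcont : ∀ {ε : ℝ}, 0 < ε → ε ≤ 1 → StronglyMeasurable (B ε) := by
    intro ε h0 h1
    refine StronglyMeasurable.integral_prod_right (f := fun v u => F u * slowWeight ε (u - v)) ?_
    exact ((hF.comp continuous_snd).mul
      ((continuous_slowWeight h0.le).comp (by fun_prop))).stronglyMeasurable
  -- Weighting the translates by `slowWeight ε (z - v)` and the conjugate character leaves the
  -- character of `y` times an average of `F`.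
  have hswap : ∀ {ε : ℝ}, 0 < ε → ε ≤ 1 → ∀ v,
      ∫ y, cexp (⟪y, ξ⟫_ℝ * I) * B ε (v + y) ∂μ = ∫ y, cexp (⟪y, ξ⟫_ℝ * I) * B ε (v + y) ∂ν := by
    intro ε h0 h1 v
    set g : V → ℂ := fun u => (F u : ℂ) * cexp (⟪u, ξ⟫_ℝ * I) with hg
    set W : V → ℂ := fun z => slowWeight ε (z - v) * cexp (-⟪z, ξ⟫_ℝ * I) with hW
    have hnorm : ∀ x : ℝ, ‖cexp (-x * I)‖ = 1 := fun x => by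
      rw [← ofReal_neg]; exact norm_exp_ofReal_mul_I _
    have hsw := continuous_slowWeight (V := V) h0.le
    have hi : ∀ (κ : Measure V) [IsProbabilityMeasure κ],
        Integrable (fun p : V × V => g (p.1 + p.2) * W p.2) (κ.prod volume) := by
      intro κ _
      have hw : Integrable (fun z : V => M * slowWeight ε (z - v)) :=
        ((integrable_slowWeight h0 h1).comp_sub_right v).const_mul M
      refine (hw.comp_snd κ).mono' ?_ (.of_forall fun p => ?_)
      · exact (by fun_prop : Continuous fun p : V × V =>
          g (p.1 + p.2) * W p.2).aestronglyMeasurable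
      · simp only [hg, hW, norm_mul, hnorm, norm_exp_ofReal_mul_I, mul_one, norm_real,
          Real.norm_of_nonneg (hF0 _), Real.norm_of_nonneg (slowWeight_pos h0.le _).le]
        exact mul_le_mul_of_nonneg_right (hFM _) (slowWeight_pos h0.le _).le
    have hval : ∀ y, ∫ z, g (y + z) * W z = cexp (⟪y, ξ⟫_ℝ * I) * B ε (v + y) := by
      intro y
      simp only [hB]
      rw [← integral_complex_ofReal, ← integral_const_mul, ← integral_add_left_eq_self (fun u =>
        cexp (⟪y, ξ⟫_ℝ * I) * ((F u * slowWeight ε (u - (v + y)) : ℝ) : ℂ)) y]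
      refine integral_congr_ae (.of_forall fun z => ?_)
      simp only [hg, hW]
      have e1 : y + z - (v + y) = z - v := by abel
      have e2 : cexp (⟪y + z, ξ⟫_ℝ * I) * cexp (-⟪z, ξ⟫_ℝ * I) = cexp (⟪y, ξ⟫_ℝ * I) := by
        rw [← Complex.exp_add, inner_add_left]
        congr 1; push_cast; ring
      rw [e1, ← e2]
      push_cast; ring
    have := integral_integral_translate_eq (hi μ) (hi ν) h
    simpa only [hval] using this
  set ε : ℕ → ℝ := fun n => 1 / ((n : ℝ) + 1) with hεdef
  have hε0 : ∀ n, 0 < ε n := fun n => by simp only [hεdef]; positivity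
  have hε1 : ∀ n, ε n ≤ 1 := fun n => by
    simp only [hεdef]
    rw [div_le_one (by positivity)]
    linarith [(Nat.cast_nonneg n : (0 : ℝ) ≤ n)]
  -- The supremum of `B (ε n)` may not be attained, but half of it is exceeded. With such a centre
  -- the normalised ratio `R` is bounded by 2, which is the dominating constant below.
  have hcenter : ∀ n, ∃ v, ∀ w, B (ε n) w ≤ 2 * B (ε n) v := by
    intro n
    have hbdd : BddAbove (Set.range (B (ε n))) :=
      ⟨_, by rintro _ ⟨v, rfl⟩; exact hBle (hε0 n) (hε1 n) v⟩
    have hs : 0 < ⨆ v, B (ε n) v := (hBpos (hε0 n) (hε1 n) 0).trans_le (le_ciSup hbdd 0)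
    obtain ⟨v, hv⟩ := exists_lt_of_lt_ciSup (half_lt_self hs)
    refine ⟨v, fun w => ?_⟩
    linarith [le_ciSup hbdd w]
  choose v hv using hcenter
  set R : ℕ → V → ℝ := fun n y => B (ε n) (v n + y) / B (ε n) (v n) with hR
  -- The ratio lies between `slowWeight (ε n) y` and its inverse; the upper bound is `hBmul` for the
  -- translation by `-y`.
  have hRlim : ∀ y, Tendsto (fun n => R n y) atTop (𝓝 1) := by
    intro y
    have hw : Tendsto (fun n => slowWeight (ε n) y) atTop (𝓝 1) := by
      have hc : ContinuousAt (fun e : ℝ => slowWeight e y) 0 := by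
        unfold slowWeight
        exact ContinuousAt.inv₀ (by fun_prop) (by simp)
      have := hc.tendsto.comp (tendsto_one_div_add_atTop_nhds_zero_nat (𝕜 := ℝ))
      rwa [show slowWeight 0 y = 1 by simp [slowWeight]] at this
    refine tendsto_of_tendsto_of_tendsto_of_le_of_le hw
      (by simpa using hw.inv₀ one_ne_zero) (fun n => ?_) (fun n => ?_)
    · simp only [hR]
      rw [le_div_iff₀ (hBpos (hε0 n) (hε1 n) _)]
      exact hBmul (hε0 n) (hε1 n) _ _
    · simp only [hR]
      rw [div_le_iff₀ (hBpos (hε0 n) (hε1 n) _), inv_mul_eq_div,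
        le_div_iff₀ (slowWeight_pos (hε0 n).le _), mul_comm]
      have := hBmul (hε0 n) (hε1 n) (v n + y) (-y)
      rw [add_neg_cancel_right] at this
      simpa [slowWeight] using this
  have hlim : ∀ (κ : Measure V) [IsProbabilityMeasure κ],
      Tendsto (fun n => ∫ y, cexp (⟪y, ξ⟫_ℝ * I) * R n y ∂κ) atTop (𝓝 (charFun κ ξ)) := by
    intro κ _
    rw [charFun_apply]
    refine tendsto_integral_of_dominated_convergence (fun _ => 2) (fun n => ?_)
      (integrable_const _) (fun n => .of_forall fun y => ?_) (.of_forall fun y => ?_)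
    · refine AEStronglyMeasurable.mul ?_ ?_
      · exact (by fun_prop : Continuous fun y : V => cexp (⟪y, ξ⟫_ℝ * I)).aestronglyMeasurable
      · have h1 : Measurable fun y => R n y :=
          ((hBcont (hε0 n) (hε1 n)).measurable.comp (measurable_const_add (v n))).div_const _
        exact (Complex.measurable_ofReal.comp h1).aestronglyMeasurable
    · rw [norm_mul, norm_exp_ofReal_mul_I, one_mul, norm_real, Real.norm_of_nonneg
        (div_nonneg (hBpos (hε0 n) (hε1 n) _).le (hBpos (hε0 n) (hε1 n) _).le),
        div_le_iff₀ (hBpos (hε0 n) (hε1 n) _)]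
      exact hv n _
    · have := (continuous_ofReal.tendsto 1).comp (hRlim y)
      simpa using this.const_mul (cexp (⟪y, ξ⟫_ℝ * I))
  refine tendsto_nhds_unique (hlim μ) ((hlim ν).congr fun n => ?_)
  simp only [hR, ofReal_div, ← mul_div_assoc, integral_div]
  rw [hswap (hε0 n) (hε1 n)]

end Uniqueness

end CharacteristicFunctions

/-! ### Equivariant Radon transforms on trees. -/

/-- Portions `a` and coordinates `c` of an equivariant Radon transform on systems of lines. -/
structure IsRadonKernel {n k : ℕ} (a c : E n → LineSystem n k → Fin k → ℝ) : Prop where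
  continuous_portion : ∀ i, Continuous fun p : E n × LineSystem n k => a p.1 p.2 i
  continuous_coord : ∀ i, Continuous fun p : E n × LineSystem n k => c p.1 p.2 i
  nonneg : ∀ y L i, 0 ≤ a y L i
  sum_eq_one : ∀ y L, ∑ i, a y L i = 1
  portion_move : ∀ (g : EuclideanGroup n) y L i, a (g y) (moveLines g L) i = a y L i
  coord_move : ∀ (g : EuclideanGroup n) y L i, c (g y) (moveLines g L) i = c y L i
  exists_ray : ∀ y L i, ∃ p : ℝ → E n, Continuous p ∧ p 0 = y ∧
    ∀ t, 0 ≤ t → c (p t) L i = c y L i + t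
  exists_growth : ∃ C : ℝ, ∀ y L i, |c y L i| ≤ ‖y‖ + ‖LineSystem.source L i‖ + C

/-- The Wasserstein distance on the tree `T` between the transforms. -/
def radonW {n k : ℕ} {G : SimpleGraph (Fin k)} (a c : E n → LineSystem n k → Fin k → ℝ)
    (μ ν : ProbabilityMeasure (E n)) (T : TreeSystem n G) : ℝ≥0∞ :=
  wasserstein (treeDist T) (splitAndProject (a · T.lines) (c · T.lines) (μ : Measure (E n)))
    (splitAndProject (a · T.lines) (c · T.lines) (ν : Measure (E n)))

/-- The tree-sliced Wasserstein distance between the transforms. -/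
def radonTSW {n k : ℕ} {G : SimpleGraph (Fin k)} (a c : E n → LineSystem n k → Fin k → ℝ)
    {𝕋 : Set (TreeSystem n G)} (σ : Measure 𝕋) (μ ν : ProbabilityMeasure (E n)) : ℝ≥0∞ :=
  ∫⁻ T : 𝕋, radonW a c μ ν T.1 ∂σ

theorem radonW_self {n k : ℕ} {G : SimpleGraph (Fin k)} (a c : E n → LineSystem n k → Fin k → ℝ)
    (hG : G.IsTree) (μ : ProbabilityMeasure (E n)) (T : TreeSystem n G) :
    radonW a c μ μ T = 0 :=
  wasserstein_self (continuous_treeDist T hG).measurable (treeDist_self T) _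

namespace IsRadonKernel

variable {n k : ℕ} {G : SimpleGraph (Fin k)} {a c : E n → LineSystem n k → Fin k → ℝ}

theorem measurable_portion (K : IsRadonKernel a c)
    (L : LineSystem n k) (i : Fin k) : Measurable fun y => a y L i :=
  ((K.continuous_portion i).comp (continuous_id.prodMk continuous_const)).measurable

theorem measurable_coord (K : IsRadonKernel a c)
    (L : LineSystem n k) (i : Fin k) : Measurable fun y => c y L i :=
  ((K.continuous_coord i).comp (continuous_id.prodMk continuous_const)).measurable

theorem portion_le_one (K : IsRadonKernel a c)
    (y : E n) (L : LineSystem n k) (i : Fin k) : a y L i ≤ 1 :=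
  le_one_of_sum_eq_one (K.nonneg y L) (K.sum_eq_one y L) i

theorem isProbabilityMeasure (K : IsRadonKernel a c)
    (L : LineSystem n k) (μ : ProbabilityMeasure (E n)) :
    IsProbabilityMeasure (splitAndProject (a · L) (c · L) (μ : Measure (E n))) :=
  isProbabilityMeasure_splitAndProject _ (K.measurable_portion L) (K.measurable_coord L)
    (fun y => K.nonneg y L) fun y => K.sum_eq_one y L

theorem measurable_radonW (K : IsRadonKernel a c) (hG : G.IsTree) (μ ν : ProbabilityMeasure (E n)) :
    Measurable fun T : TreeSystem n G => radonW a c μ ν T :=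
  measurable_wasserstein_treeDist hG K.continuous_portion K.continuous_coord K.nonneg
    K.sum_eq_one μ ν

theorem radonW_triangle (K : IsRadonKernel a c)
    (hG : G.IsTree) (μ ν ρ : ProbabilityMeasure (E n)) (T : TreeSystem n G) :
    radonW a c μ ρ T ≤ radonW a c μ ν T + radonW a c ν ρ T := by
  have := K.isProbabilityMeasure T.lines ν
  exact wasserstein_triangle (continuous_treeDist T hG).measurable (treeDist_nonneg T)
    (treeDist_triangle T hG) _ _ _

/-- The part of the transform on one line, away from the gluing points, is determined up to
Wasserstein distance zero. -/
theorem integral_eq_of_radonW_eq_zero (K : IsRadonKernel a c)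
    (hG : G.IsTree) {μ ν : ProbabilityMeasure (E n)}
    {T : TreeSystem n G} (h : radonW a c μ ν T = 0) (i : Fin k) {ψ : ℝ → ℝ} {M C : ℝ}
    (hψM : ∀ t, |ψ t| ≤ M) (hC : 0 ≤ C) (hψC : ∀ t u, |ψ t - ψ u| ≤ C * |t - u|)
    (hψm : Measurable ψ) (hglue : ∀ j, G.Adj i j → ψ (T.glue i j) = 0) :
    ∫ y, a y T.lines i * ψ (c y T.lines i) ∂(μ : Measure (E n))
      = ∫ y, a y T.lines i * ψ (c y T.lines i) ∂(ν : Measure (E n)) := by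
  -- Extension of `ψ` by zero to the other lines: compatible with the gluing because `ψ` vanishes at
  -- the gluing points of line `i`.
  set φ : TreePoint k → ℝ := fun p => if p.1 = i then ψ p.2 else 0 with hφ
  have hM : 0 ≤ M := (abs_nonneg _).trans (hψM 0)
  have hφM : ∀ p, |φ p| ≤ M := fun p => by
    simp only [hφ]; split_ifs
    · exact hψM _
    · simpa using hM
  have hφm : Measurable φ :=
    Measurable.ite (measurable_fst (measurableSet_singleton i)) (hψm.comp measurable_snd)
      measurable_const
  have hLip := abs_sub_le_treeDist T hG (φ := φ) hC
    (fun j t u => by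
      simp only [hφ]; split_ifs
      · exact hψC t u
      · simpa using mul_nonneg hC (abs_nonneg (t - u)))
    (fun j l hjl => by
      simp only [hφ]; split_ifs with h1 h2 h2
      · exact absurd (h1.trans h2.symm) hjl.ne
      · subst h1; exact hglue l hjl
      · subst h2; exact (hglue j hjl.symm).symm
      · rfl)
  have := K.isProbabilityMeasure T.lines μ
  have key := integral_eq_of_wasserstein_eq_zero h hφm hφM hC hLip
  have e : ∀ κ : ProbabilityMeasure (E n),
      ∫ p, φ p ∂(splitAndProject (a · T.lines) (c · T.lines) (κ : Measure (E n)))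
        = ∫ y, a y T.lines i * ψ (c y T.lines i) ∂(κ : Measure (E n)) := by
    intro κ
    rw [integral_splitAndProject _ (K.measurable_portion _) (K.measurable_coord _)
      (fun y => K.nonneg y _) (fun y => K.sum_eq_one y _) hφm hφM,
      Finset.sum_eq_single i (fun j _ hj => by simp [hφ, hj]) (by simp)]
    simp [hφ]
  rwa [e, e] at key

theorem continuous_integral (K : IsRadonKernel a c)
    (μ : ProbabilityMeasure (E n)) (i : Fin k) {ψ : ℝ → ℝ} {M : ℝ}
    (hψ : Continuous ψ) (hψM : ∀ t, |ψ t| ≤ M) :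
    Continuous fun T : TreeSystem n G =>
      ∫ y, a y T.lines i * ψ (c y T.lines i) ∂(μ : Measure (E n)) := by
  refine continuous_of_dominated (bound := fun _ => M) (fun T => ?_)
    (fun T => .of_forall fun y => ?_) (integrable_const _) (.of_forall fun y => ?_)
  · exact ((K.measurable_portion _ i).mul
      (hψ.measurable.comp (K.measurable_coord _ i))).aestronglyMeasurable
  · rw [Real.norm_eq_abs, abs_mul, abs_of_nonneg (K.nonneg _ _ _)]
    calc a y T.lines i * |ψ (c y T.lines i)| ≤ 1 * M :=
          mul_le_mul (K.portion_le_one _ _ _) (hψM _) (abs_nonneg _) zero_le_one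
      _ = M := one_mul M
  · exact ((K.continuous_portion i).comp (continuous_const.prodMk continuous_lines)).mul
      (hψ.comp ((K.continuous_coord i).comp (continuous_const.prodMk continuous_lines)))

theorem isExtendedMetric (K : IsRadonKernel a c)
    (hG : G.IsTree) {𝕋 : Set (TreeSystem n G)} {σ : Measure 𝕋}
    (hinj : ∀ μ ν : ProbabilityMeasure (E n), radonTSW a c σ μ ν = 0 → μ = ν) :
    IsExtendedMetric (radonTSW a c σ) where
  eq_zero_iff μ ν := by
    refine ⟨hinj μ ν, ?_⟩
    rintro rfl
    simp [radonTSW, radonW_self a c hG]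
  symm μ ν := lintegral_congr fun T => wasserstein_comm (treeDist_comm T.1) _ _
  triangle μ ν ρ := by
    rw [radonTSW, radonTSW, radonTSW, ← lintegral_add_left
      (f := fun T : 𝕋 => radonW a c μ ν T.1)
      ((K.measurable_radonW hG μ ν).comp measurable_subtype_coe)]
    exact lintegral_mono fun T => K.radonW_triangle hG μ ν ρ T.1

variable {𝕋 : Set (TreeSystem n G)} {σ : Measure 𝕋} [σ.IsOpenPosMeasure]

/-- Vanishing almost everywhere gives a dense set of good trees, as `σ` charges open sets, and the
equality of the integrals is a closed condition on the tree. -/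
theorem integral_eq_of_radonTSW_eq_zero (K : IsRadonKernel a c)
    (hG : G.IsTree) {μ ν : ProbabilityMeasure (E n)}
    (h : radonTSW a c σ μ ν = 0) {T : TreeSystem n G} (hT : T ∈ 𝕋) (i : Fin k)
    {t₀ δ : ℝ} (hδ : ∀ j, G.Adj i j → δ < |T.glue i j - t₀|)
    {ψ : ℝ → ℝ} {M C : ℝ} (hψM : ∀ t, |ψ t| ≤ M) (hC : 0 ≤ C)
    (hψC : ∀ t u, |ψ t - ψ u| ≤ C * |t - u|) (hψ : Continuous ψ)
    (hsupp : ∀ t, δ ≤ |t - t₀| → ψ t = 0) :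
    ∫ y, a y T.lines i * ψ (c y T.lines i) ∂(μ : Measure (E n))
      = ∫ y, a y T.lines i * ψ (c y T.lines i) ∂(ν : Measure (E n)) := by
  have hae : ∀ᵐ T : 𝕋 ∂σ, radonW a c μ ν T.1 = 0 :=
    (lintegral_eq_zero_iff ((K.measurable_radonW hG μ ν).comp measurable_subtype_coe)).1 h
  have hdense := Measure.dense_of_ae hae
  have hglue : ∀ i j, Continuous fun T : 𝕋 => T.1.glue i j := fun i j =>
    (continuous_apply_apply i j).comp (continuous_glue.comp continuous_subtype_val)
  -- The test function must also vanish at the gluing points of the approximating trees. The strict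
  -- inequality makes this an open condition.
  set U : Set 𝕋 := {T | ∀ j, G.Adj i j → δ < |T.1.glue i j - t₀|} with hU
  have hUo : IsOpen U := by
    simp only [hU, Set.ofPred_forall]
    refine isOpen_iInter_of_finite fun j => isOpen_iInter_of_finite fun _ => ?_
    exact isOpen_lt continuous_const ((hglue i j).sub continuous_const).abs
  have hclosed : IsClosed {T : 𝕋 |
      ∫ y, a y T.1.lines i * ψ (c y T.1.lines i) ∂(μ : Measure (E n))
        = ∫ y, a y T.1.lines i * ψ (c y T.1.lines i) ∂(ν : Measure (E n))} :=
    isClosed_eq ((K.continuous_integral μ i hψ hψM).comp continuous_subtype_val)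
      ((K.continuous_integral ν i hψ hψM).comp continuous_subtype_val)
  have hsub : closure (U ∩ {T : 𝕋 | radonW a c μ ν T.1 = 0}) ⊆ _ :=
    closure_minimal (fun T' hT' => K.integral_eq_of_radonW_eq_zero hG hT'.2 i hψM hC hψC
      hψ.measurable fun j hj => hsupp _ (hT'.1 j hj).le) hclosed
  exact hsub (hdense.open_subset_closure_inter hUo (show (⟨T, hT⟩ : 𝕋) ∈ U from hδ))

/-- By equivariance, moving the tree by `g⁻¹` amounts to moving the point by `g`. -/
theorem integral_comp_eq_of_radonTSW_eq_zero (K : IsRadonKernel a c)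
    (hG : G.IsTree) {μ ν : ProbabilityMeasure (E n)}
    (h : radonTSW a c σ μ ν = 0) (h𝕋 : IsEuclideanStable 𝕋) {T : TreeSystem n G} (hT : T ∈ 𝕋)
    (i : Fin k) {t₀ δ : ℝ} (hδ : ∀ j, G.Adj i j → δ < |T.glue i j - t₀|)
    {ψ : ℝ → ℝ} {M C : ℝ} (hψM : ∀ t, |ψ t| ≤ M) (hC : 0 ≤ C)
    (hψC : ∀ t u, |ψ t - ψ u| ≤ C * |t - u|) (hψ : Continuous ψ)
    (hsupp : ∀ t, δ ≤ |t - t₀| → ψ t = 0) (g : EuclideanGroup n) :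
    ∫ y, a (g y) T.lines i * ψ (c (g y) T.lines i) ∂(μ : Measure (E n))
      = ∫ y, a (g y) T.lines i * ψ (c (g y) T.lines i) ∂(ν : Measure (E n)) := by
  have key := K.integral_eq_of_radonTSW_eq_zero hG h (h𝕋 g.symm T hT) i hδ hψM hC hψC hψ hsupp
  have ea : ∀ y, a y (T.move g.symm).lines i = a (g y) T.lines i := fun y => by
    rw [← K.portion_move g.symm (g y), AffineIsometryEquiv.symm_apply_apply]; rfl
  have ec : ∀ y, c y (T.move g.symm).lines i = c (g y) T.lines i := fun y => by
    rw [← K.coord_move g.symm (g y), AffineIsometryEquiv.symm_apply_apply]; rfl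
  simpa only [ea, ec] using key

/-- There is a point some of whose mass is sent to a point which is not a gluing point. -/
theorem exists_portion_pos (K : IsRadonKernel a c) (T : TreeSystem n G) :
    ∃ (i : Fin k) (y : E n) (δ : ℝ), 0 < δ ∧ 0 < a y T.lines i ∧
      ∀ j, δ < |T.glue i j - c y T.lines i| := by
  obtain ⟨i, -, hi⟩ : ∃ i ∈ Finset.univ, 0 < a 0 T.lines i := by
    refine Finset.exists_lt_of_sum_lt (f := fun _ => 0) ?_
    simp [K.sum_eq_one]
  obtain ⟨p, hp, hp0, hpc⟩ := K.exists_ray 0 T.lines i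
  have hpos : ∀ᶠ t in 𝓝[>] (0 : ℝ), 0 < a (p t) T.lines i := by
    have : Continuous fun t => a (p t) T.lines i :=
      (K.continuous_portion i).comp (hp.prodMk continuous_const)
    refine nhdsWithin_le_nhds (this.continuousAt.eventually (lt_mem_nhds ?_))
    simpa [hp0] using hi
  -- The origin itself may be sent to a gluing point. Along the ray the coordinate increases, and it
  -- avoids the finitely many gluing coordinates for small `t > 0`.
  have hne : ∀ᶠ t in 𝓝[>] (0 : ℝ), ∀ j, T.glue i j ≠ c 0 T.lines i + t := by
    rw [eventually_all]
    intro j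
    rcases le_or_gt (T.glue i j - c 0 T.lines i) 0 with hj | hj
    · filter_upwards [self_mem_nhdsWithin] with t (ht : 0 < t) h
      linarith
    · filter_upwards [nhdsWithin_le_nhds (gt_mem_nhds hj)] with t ht h
      linarith
  obtain ⟨t, ⟨ht1, ht2⟩, ht0 : 0 < t⟩ := ((hpos.and hne).and self_mem_nhdsWithin).exists
  have hgap : ∀ᶠ δ in 𝓝[>] (0 : ℝ), ∀ j, δ < |T.glue i j - c (p t) T.lines i| := by
    rw [eventually_all]
    intro j
    refine nhdsWithin_le_nhds (gt_mem_nhds (abs_pos.2 (sub_ne_zero.2 ?_)))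
    rw [hpc t ht0.le]
    exact ht2 j
  obtain ⟨δ, hδ, hδ0⟩ := (hgap.and self_mem_nhdsWithin).exists
  exact ⟨i, p t, δ, hδ0, ht1, hδ⟩

end IsRadonKernel

/-! ### Finiteness under first moments. -/

section FirstMoment

variable {n k : ℕ} {G : SimpleGraph (Fin k)} {a c : E n → LineSystem n k → Fin k → ℝ}

theorem IsRadonKernel.lintegral_abs_coord_le (K : IsRadonKernel a c) {C : ℝ}
    (hC : ∀ y L i, |c y L i| ≤ ‖y‖ + ‖LineSystem.source L i‖ + C)
    (L : LineSystem n k) (μ : ProbabilityMeasure (E n)) :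
    ∫⁻ p, ENNReal.ofReal |p.2| ∂(splitAndProject (a · L) (c · L) (μ : Measure (E n)))
      ≤ k * ((∫⁻ y, ENNReal.ofReal ‖y‖ ∂(μ : Measure (E n)))
        + ENNReal.ofReal (∑ i, ‖L.source i‖) + ENNReal.ofReal C) := by
  rw [lintegral_splitAndProject _ (K.measurable_portion L) (K.measurable_coord L)
    (f := fun p => ENNReal.ofReal |p.2|) (by fun_prop)]
  have hi : ∀ i ∈ Finset.univ, ∫⁻ y, ENNReal.ofReal (a y L i) * ENNReal.ofReal |c y L i|
      ∂(μ : Measure (E n)) ≤ (∫⁻ y, ENNReal.ofReal ‖y‖ ∂(μ : Measure (E n)))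
        + ENNReal.ofReal (∑ i, ‖L.source i‖) + ENNReal.ofReal C := by
    intro i _
    calc ∫⁻ y, ENNReal.ofReal (a y L i) * ENNReal.ofReal |c y L i| ∂(μ : Measure (E n))
        ≤ ∫⁻ y, (ENNReal.ofReal ‖y‖ + (ENNReal.ofReal (∑ i, ‖L.source i‖) + ENNReal.ofReal C))
            ∂(μ : Measure (E n)) := by
          refine lintegral_mono fun y => ?_
          have h1 : ENNReal.ofReal (a y L i) ≤ 1 := ENNReal.ofReal_le_one.2 (K.portion_le_one _ _ _)
          have h2 : ‖L.source i‖ ≤ ∑ i, ‖L.source i‖ :=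
            Finset.single_le_sum (f := fun i => ‖L.source i‖) (fun _ _ => norm_nonneg _)
              (Finset.mem_univ i)
          calc ENNReal.ofReal (a y L i) * ENNReal.ofReal |c y L i|
              ≤ 1 * ENNReal.ofReal (‖y‖ + (∑ i, ‖L.source i‖ + C)) := by
                gcongr
                linarith [hC y L i]
            _ ≤ _ := by
                rw [one_mul]
                exact ENNReal.ofReal_add_le.trans (add_le_add le_rfl ENNReal.ofReal_add_le)
      _ = _ := by
          rw [lintegral_add_left (by fun_prop)]
          simp [add_assoc]
  exact (Finset.sum_le_sum hi).trans_eq (by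
    rw [Finset.sum_const, Finset.card_univ, Fintype.card_fin, nsmul_eq_mul])

theorem IsRadonKernel.radonTSW_ne_top (K : IsRadonKernel a c) (hG : G.IsTree)
    {𝕋 : Set (TreeSystem n G)} {σ : Measure 𝕋} [IsProbabilityMeasure σ]
    (hσ : TreeLawHasFirstMoment σ) {μ ν : ProbabilityMeasure (E n)}
    (hμ : Integrable (fun y => ‖y‖) (μ : Measure (E n)))
    (hν : Integrable (fun y => ‖y‖) (ν : Measure (E n))) : radonTSW a c σ μ ν ≠ ∞ := by
  obtain ⟨C, hC⟩ := K.exists_growth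
  set m : 𝕋 → ℝ := fun T => (∑ i, ‖T.1.lines.source i‖) + ∑ i, ∑ j, |T.1.glue i j| with hm
  set Mμ := ∫⁻ y, ENNReal.ofReal ‖y‖ ∂(μ : Measure (E n)) with hMμ
  set Mν := ∫⁻ y, ENNReal.ofReal ‖y‖ ∂(ν : Measure (E n)) with hMν
  have hMμ_top : Mμ ≠ ∞ := hμ.lintegral_lt_top.ne
  have hMν_top : Mν ≠ ∞ := hν.lintegral_lt_top.ne
  have hm_top : ∫⁻ T, ENNReal.ofReal (m T) ∂σ ≠ ∞ := hσ.lintegral_lt_top.ne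
  set A : ℝ≥0∞ := k * (Mμ + ENNReal.ofReal C) + k * (Mν + ENNReal.ofReal C) with hA
  -- Of the coefficient `4 * k`, the sources contribute `k` for each of the two measures, and the
  -- gluing coordinates contribute `2 * k` through `treeDist_le`.
  have hbound : ∀ T : 𝕋, radonW a c μ ν T.1 ≤ A + 4 * k * ENNReal.ofReal (m T) := by
    intro T
    have hg0 : 0 ≤ ∑ i, ∑ j, |T.1.glue i j| :=
      Finset.sum_nonneg fun _ _ => Finset.sum_nonneg fun _ _ => abs_nonneg _
    have hs0 : 0 ≤ ∑ i, ‖T.1.lines.source i‖ := Finset.sum_nonneg fun _ _ => norm_nonneg _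
    have hs : ENNReal.ofReal (∑ i, ‖T.1.lines.source i‖) ≤ ENNReal.ofReal (m T) :=
      ENNReal.ofReal_le_ofReal (by simp only [hm]; linarith)
    have hg : ENNReal.ofReal (2 * k * ∑ i, ∑ j, |T.1.glue i j|) ≤ 2 * k * ENNReal.ofReal (m T) := by
      rw [ENNReal.ofReal_mul (by positivity), ENNReal.ofReal_mul (by positivity)]
      simp only [ENNReal.ofReal_ofNat, ENNReal.ofReal_natCast]
      gcongr
      simp only [hm]; linarith
    have := K.isProbabilityMeasure T.1.lines μ
    have := K.isProbabilityMeasure T.1.lines ν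
    calc radonW a c μ ν T.1
        ≤ ∫⁻ p, ENNReal.ofReal (|p.2| + 2 * k * ∑ i, ∑ j, |T.1.glue i j|)
              ∂(splitAndProject (a · T.1.lines) (c · T.1.lines) (μ : Measure (E n)))
            + ∫⁻ p, ENNReal.ofReal |p.2|
              ∂(splitAndProject (a · T.1.lines) (c · T.1.lines) (ν : Measure (E n))) := by
          refine wasserstein_le_add (by fun_prop) (by fun_prop) fun p q => ?_
          linarith [treeDist_le T.1 hG p q]
      _ ≤ (∫⁻ p, ENNReal.ofReal |p.2|
              ∂(splitAndProject (a · T.1.lines) (c · T.1.lines) (μ : Measure (E n)))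
            + ENNReal.ofReal (2 * k * ∑ i, ∑ j, |T.1.glue i j|))
            + ∫⁻ p, ENNReal.ofReal |p.2|
              ∂(splitAndProject (a · T.1.lines) (c · T.1.lines) (ν : Measure (E n))) := by
          gcongr
          refine (lintegral_mono fun p => ENNReal.ofReal_add_le).trans_eq ?_
          rw [lintegral_add_right _ measurable_const]
          simp
      _ ≤ (k * (Mμ + ENNReal.ofReal (m T) + ENNReal.ofReal C) + 2 * k * ENNReal.ofReal (m T))
            + k * (Mν + ENNReal.ofReal (m T) + ENNReal.ofReal C) := by
          gcongr
          · exact (K.lintegral_abs_coord_le hC _ μ).trans (by gcongr)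
          · exact (K.lintegral_abs_coord_le hC _ ν).trans (by gcongr)
      _ = A + 4 * k * ENNReal.ofReal (m T) := by
          simp only [hA]; ring
  have hA_top : A ≠ ∞ := by finiteness
  have h4 : (4 * k : ℝ≥0∞) ≠ ∞ := by finiteness
  refine ne_top_of_le_ne_top ?_ (lintegral_mono hbound)
  rw [lintegral_add_left measurable_const, lintegral_const_mul' _ _ h4]
  simp only [lintegral_const, measure_univ, mul_one]
  finiteness

theorem IsExtendedMetric.isMetricOn {X : Type*} {D : X → X → ℝ≥0∞} (h : IsExtendedMetric D)
    {S : Set X} (hS : ∀ x ∈ S, ∀ y ∈ S, D x y ≠ ∞) : IsMetricOn S D :=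
  ⟨hS, fun x _ y _ => h.eq_zero_iff x y, fun x _ y _ => h.symm x y,
    fun x _ y _ z _ => h.triangle x y z⟩

end FirstMoment

/-! ### Tent functions as test functions. -/

section Tent

/-- The tent function of height and radius `δ` around `t₀`. -/
def tent (t₀ δ t : ℝ) : ℝ := max 0 (δ - |t - t₀|)

variable (t₀ δ : ℝ)

theorem tent_nonneg (t : ℝ) : 0 ≤ tent t₀ δ t := le_max_left _ _

theorem tent_self {δ : ℝ} (hδ : 0 < δ) : 0 < tent t₀ δ t₀ := by
  simp [tent, hδ]

theorem tent_le {δ : ℝ} (hδ : 0 < δ) (t : ℝ) : tent t₀ δ t ≤ δ :=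
  max_le hδ.le (by linarith [abs_nonneg (t - t₀)])

theorem tent_eq_zero {t : ℝ} (h : δ ≤ |t - t₀|) : tent t₀ δ t = 0 :=
  max_eq_left (by linarith)

theorem abs_tent_sub (t u : ℝ) : |tent t₀ δ t - tent t₀ δ u| ≤ |t - u| := by
  have h1 := abs_max_sub_max_le_abs (δ - |t - t₀|) (δ - |u - t₀|) 0
  have h2 := abs_abs_sub_abs_le (u - t₀) (t - t₀)
  rw [sub_sub_sub_cancel_right, abs_sub_comm u t] at h2
  rw [sub_sub_sub_cancel_left] at h1
  simp only [tent, max_comm (0 : ℝ)]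
  exact h1.trans h2

@[fun_prop]
theorem continuous_tent : Continuous (tent t₀ δ) := by
  unfold tent; fun_prop

/-- A tent modulated by a bounded Lipschitz function is Lipschitz. -/
theorem abs_tent_mul_sub {δ : ℝ} (hδ : 0 < δ) {f : ℝ → ℝ} {C : ℝ} (hf : ∀ t, |f t| ≤ 1)
    (hC : ∀ t u, |f t - f u| ≤ C * |t - u|) (t u : ℝ) :
    |tent t₀ δ t * f t - tent t₀ δ u * f u| ≤ (1 + δ * C) * |t - u| := by
  have e : tent t₀ δ t * f t - tent t₀ δ u * f u
      = (tent t₀ δ t - tent t₀ δ u) * f t + tent t₀ δ u * (f t - f u) := by ring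
  rw [e]
  refine (abs_add_le _ _).trans ?_
  rw [abs_mul, abs_mul, abs_of_nonneg (tent_nonneg _ _ u)]
  have h1 : |tent t₀ δ t - tent t₀ δ u| * |f t| ≤ |t - u| * 1 :=
    mul_le_mul (abs_tent_sub _ _ _ _) (hf t) (abs_nonneg _) (abs_nonneg _)
  have h2 : tent t₀ δ u * |f t - f u| ≤ δ * (C * |t - u|) :=
    mul_le_mul (tent_le _ hδ u) (hC t u) (abs_nonneg _) hδ.le
  linarith

end Tent

/-! ### Vanishing distance forces equal measures. -/

section Injectivity

variable {n k : ℕ} {G : SimpleGraph (Fin k)} {a c : E n → LineSystem n k → Fin k → ℝ}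
  {𝕋 : Set (TreeSystem n G)} {σ : Measure 𝕋} [IsProbabilityMeasure σ] [σ.IsOpenPosMeasure]

/-- Injectivity if the points with coordinates in a bounded set form a bounded set. -/
theorem IsRadonKernel.eq_of_radonTSW_eq_zero_of_proper (K : IsRadonKernel a c) (hG : G.IsTree)
    (h𝕋 : IsEuclideanStable 𝕋) (hproper : ∀ L i, ∃ C, ∀ y, ‖y‖ ≤ |c y L i| + C)
    {μ ν : ProbabilityMeasure (E n)} (h : radonTSW a c σ μ ν = 0) : μ = ν := by
  obtain ⟨⟨T, hT⟩⟩ := nonempty_of_isProbabilityMeasure σ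
  obtain ⟨i, y₀, δ, hδ, hpos, hgap⟩ := K.exists_portion_pos T
  set t₀ := c y₀ T.lines i
  have key := K.integral_comp_eq_of_radonTSW_eq_zero hG h h𝕋 hT i (t₀ := t₀) (δ := δ)
    (fun j _ => hgap j) (ψ := tent t₀ δ) (M := δ) (C := 1)
    (fun t => by rw [abs_of_nonneg (tent_nonneg _ _ t)]; exact tent_le _ hδ t) zero_le_one
    (fun t u => by rw [one_mul]; exact abs_tent_sub _ _ t u) (continuous_tent _ _)
    (fun t ht => tent_eq_zero _ _ ht)
  obtain ⟨C, hC⟩ := hproper T.lines i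
  have ha : Continuous fun y => a y T.lines i :=
    (K.continuous_portion i).comp (continuous_id.prodMk continuous_const)
  have hc : Continuous fun y => c y T.lines i :=
    (K.continuous_coord i).comp (continuous_id.prodMk continuous_const)
  suffices hμν : (μ : Measure (E n)) = ν from Subtype.ext hμν
  refine eq_of_forall_integral_translate_eq
    (F := fun y => a y T.lines i * tent t₀ δ (c y T.lines i)) (by fun_prop)
    (fun y => mul_nonneg (K.nonneg _ _ _) (tent_nonneg _ _ _)) ?_
    ⟨y₀, mul_pos hpos (tent_self _ hδ)⟩ fun z => ?_
  · refine HasCompactSupport.intro (isCompact_closedBall (0 : E n) (|t₀| + δ + C)) fun y hy => ?_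
    rw [mem_closedBall_zero_iff, not_le] at hy
    rw [tent_eq_zero, mul_zero]
    linarith [hC y, abs_sub_abs_le_abs_sub (c y T.lines i) t₀]
  · have := key (AffineIsometryEquiv.constVAdd ℝ (E n) z)
    simpa only [AffineIsometryEquiv.coe_constVAdd, vadd_eq_add, add_comm z] using this

/-- Two vectors of equal norm are exchanged by the reflection in the hyperplane bisecting them. -/
theorem exists_linearIsometryEquiv_apply_eq (θ ξ : E n) (hθ : ‖θ‖ = 1) :
    ∃ Q : E n ≃ₗᵢ[ℝ] E n, Q ξ = ‖ξ‖ • θ := by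
  refine ⟨Submodule.reflection (ℝ ∙ (ξ - ‖ξ‖ • θ))ᗮ, Submodule.reflection_sub ?_⟩
  rw [norm_smul, hθ, norm_norm, mul_one]

/-- Injectivity if the coordinate is the orthogonal projection to the line. -/
theorem IsRadonKernel.eq_of_radonTSW_eq_zero_of_inner (K : IsRadonKernel a c) (hG : G.IsTree)
    (h𝕋 : IsEuclideanStable 𝕋)
    (hinner : ∀ y (L : LineSystem n k) i, c y L i = ⟪y - L.source i, L.dir i⟫_ℝ)
    {μ ν : ProbabilityMeasure (E n)} (h : radonTSW a c σ μ ν = 0) : μ = ν := by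
  obtain ⟨⟨T, hT⟩⟩ := nonempty_of_isProbabilityMeasure σ
  obtain ⟨i, y₀, δ, hδ, hpos, hgap⟩ := K.exists_portion_pos T
  set t₀ := c y₀ T.lines i
  set θ := T.lines.dir i
  set x := T.lines.source i
  have hθ : ‖θ‖ = 1 := by simp [θ, LineSystem.dir]
  have ha : Continuous fun y => a y T.lines i :=
    (K.continuous_portion i).comp (continuous_id.prodMk continuous_const)
  have hc : Continuous fun y => c y T.lines i :=
    (K.continuous_coord i).comp (continuous_id.prodMk continuous_const)
  suffices hμν : (μ : Measure (E n)) = ν from Subtype.ext hμν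
  refine Measure.ext_of_charFun (funext fun ξ => ?_)
  obtain ⟨Q, hQ⟩ := exists_linearIsometryEquiv_apply_eq θ ξ hθ
  set F : E n → ℝ := fun y => a (Q y) T.lines i * tent t₀ δ (c (Q y) T.lines i) with hFdef
  have hFc : Continuous F := by
    have := ha.comp Q.continuous
    have := hc.comp Q.continuous
    fun_prop
  have hF0 : ∀ y, 0 ≤ F y := fun y => mul_nonneg (K.nonneg _ _ _) (tent_nonneg _ _ _)
  have hFδ : ∀ y, F y ≤ δ := fun y => by
    have := mul_le_mul (K.portion_le_one (Q y) T.lines i) (tent_le t₀ hδ (c (Q y) T.lines i))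
      (tent_nonneg _ _ _) zero_le_one
    simpa [hFdef] using this
  -- After the rotation the pairing with `ξ` is an affine function of the line coordinate, so a
  -- modulation at frequency `ξ` is an admissible test function on the line.
  have hphase : ∀ y, ‖ξ‖ * c (Q y) T.lines i + ‖ξ‖ * ⟪x, θ⟫_ℝ = ⟪y, ξ⟫_ℝ := by
    intro y
    rw [hinner, ← mul_add, ← inner_add_left, sub_add_cancel, ← real_inner_smul_right, ← hQ,
      Q.inner_map_map]
  have key : ∀ f : ℝ → ℝ, Continuous f → (∀ t, |f t| ≤ 1) → (∀ t u, |f t - f u| ≤ |t - u|) →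
      ∀ z, ∫ y, F (y + z) * f ⟪y + z, ξ⟫_ℝ ∂(μ : Measure (E n))
        = ∫ y, F (y + z) * f ⟪y + z, ξ⟫_ℝ ∂(ν : Measure (E n)) := by
    intro f hfc hf1 hfL z
    set f' : ℝ → ℝ := fun t => f (‖ξ‖ * t + ‖ξ‖ * ⟪x, θ⟫_ℝ) with hf'
    have := K.integral_comp_eq_of_radonTSW_eq_zero hG h h𝕋 hT i (t₀ := t₀) (δ := δ)
      (fun j _ => hgap j) (ψ := fun t => tent t₀ δ t * f' t) (M := δ) (C := 1 + δ * ‖ξ‖)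
      (fun t => ?_) (by positivity)
      (fun t u => abs_tent_mul_sub _ hδ (f := f') (fun t => hf1 _) (fun t u => ?_) t u)
      (by fun_prop)
      (fun t ht => by rw [tent_eq_zero _ _ ht, zero_mul])
      (Q.toAffineIsometryEquiv.trans (AffineIsometryEquiv.constVAdd ℝ (E n) (Q z)))
    · have e : ∀ y, (Q.toAffineIsometryEquiv.trans
          (AffineIsometryEquiv.constVAdd ℝ (E n) (Q z))) y = Q (y + z) := fun y => by
        simp [add_comm]
      simpa only [e, hf', hphase, ← mul_assoc] using this
    · rw [abs_mul, abs_of_nonneg (tent_nonneg _ _ t)]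
      simpa using mul_le_mul (tent_le t₀ hδ t) (hf1 _) (abs_nonneg _) hδ.le
    · refine (hfL _ _).trans_eq ?_
      rw [add_sub_add_right_eq_sub, ← mul_sub, abs_mul, abs_norm]
  refine charFun_eq_of_forall_integral_modulated_eq hFc hF0 hFδ
    ⟨Q.symm y₀, by simpa [hFdef] using mul_pos hpos (tent_self t₀ hδ)⟩ ξ fun z => ?_
  -- The test functions on trees are real, so the character is split into cosine and sine.
  have hsplit : ∀ κ : ProbabilityMeasure (E n),
      ∫ y, (F (y + z) : ℂ) * Complex.exp (⟪y + z, ξ⟫_ℝ * Complex.I) ∂(κ : Measure (E n))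
        = ((∫ y, F (y + z) * Real.cos ⟪y + z, ξ⟫_ℝ ∂(κ : Measure (E n)) : ℝ) : ℂ)
          + ((∫ y, F (y + z) * Real.sin ⟪y + z, ξ⟫_ℝ ∂(κ : Measure (E n)) : ℝ) : ℂ)
            * Complex.I := by
    intro κ
    have hint : ∀ f : ℝ → ℝ, Continuous f → (∀ t, |f t| ≤ 1) →
        Integrable (fun y => F (y + z) * f ⟪y + z, ξ⟫_ℝ) (κ : Measure (E n)) := by
      intro f hfc hf1
      refine Integrable.of_bound (Continuous.aestronglyMeasurable (by fun_prop)) δ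
        (.of_forall fun y => ?_)
      rw [Real.norm_eq_abs, abs_mul, abs_of_nonneg (hF0 _)]
      simpa using mul_le_mul (hFδ (y + z)) (hf1 _) (abs_nonneg _) hδ.le
    rw [← integral_complex_ofReal, ← integral_complex_ofReal, ← integral_mul_const,
      ← integral_add (hint _ Real.continuous_cos Real.abs_cos_le_one).ofReal
        ((hint _ Real.continuous_sin Real.abs_sin_le_one).ofReal.mul_const _)]
    refine integral_congr_ae (.of_forall fun y => ?_)
    simp only [Complex.exp_mul_I]
    push_cast; ring
  rw [hsplit, hsplit, key _ Real.continuous_cos Real.abs_cos_le_one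
      (fun t u => by simpa [Real.dist_eq] using Real.lipschitzWith_cos.dist_le_mul t u),
    key _ Real.continuous_sin Real.abs_sin_le_one
      (fun t u => by simpa [Real.dist_eq] using Real.lipschitzWith_sin.dist_le_mul t u)]

end Injectivity

/-! ### The circular and the spatial transform as equivariant kernels. -/

section Kernels

variable {n k : ℕ}

theorem continuous_source (i : Fin k) :
    Continuous fun L : LineSystem n k => L.source i :=
  continuous_fst.comp (continuous_apply i)

theorem continuous_dir (i : Fin k) : Continuous fun L : LineSystem n k => L.dir i :=
  continuous_subtype_val.comp (continuous_snd.comp (continuous_apply i))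

theorem norm_dir (L : LineSystem n k) (i : Fin k) : ‖L.dir i‖ = 1 := by
  simp [LineSystem.dir]

theorem sub_source_moveLines (g : EuclideanGroup n) (y : E n) (L : LineSystem n k) (i : Fin k) :
    g y - (moveLines g L).source i = g.linearIsometryEquiv (y - L.source i) :=
  (g.map_vsub y (L.source i)).symm

theorem dir_moveLines (g : EuclideanGroup n) (L : LineSystem n k) (i : Fin k) :
    (moveLines g L).dir i = g.linearIsometryEquiv (L.dir i) := rfl

/-- The kernel properties follow from those of the coordinates. -/
theorem SplittingMap.isRadonKernel {α : SplittingMap n k} (hα : α.IsInvariant)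
    {c : E n → LineSystem n k → Fin k → ℝ}
    (hc : ∀ i, Continuous fun p : E n × LineSystem n k => c p.1 p.2 i)
    (hmove : ∀ (g : EuclideanGroup n) y L i, c (g y) (moveLines g L) i = c y L i)
    (hray : ∀ y L i, ∃ p : ℝ → E n, Continuous p ∧ p 0 = y ∧
      ∀ t, 0 ≤ t → c (p t) L i = c y L i + t)
    (hgrowth : ∃ C : ℝ, ∀ y L i, |c y L i| ≤ ‖y‖ + ‖LineSystem.source L i‖ + C) :
    IsRadonKernel (fun y L i => (α (y, L)).1 i) c where
  continuous_portion i := (continuous_apply i).comp (continuous_subtype_val.comp α.continuous)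
  continuous_coord := hc
  nonneg y L i := (α (y, L)).2.1 i
  sum_eq_one y L := (α (y, L)).2.2
  portion_move g y L i := by rw [hα]
  coord_move := hmove
  exists_ray := hray
  exists_growth := hgrowth

theorem isRadonKernel_circular {α : SplittingMap n k} (hα : α.IsInvariant) (r : ℝ) :
    IsRadonKernel (fun y L i => (α (y, L)).1 i)
      (fun y (L : LineSystem n k) i => ‖y - L.source i - r • L.dir i‖) := by
  refine SplittingMap.isRadonKernel hα (fun i => ?_) (fun g y L i => ?_) (fun y L i => ?_)
    ⟨|r|, fun y L i => ?_⟩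
  · have h1 := (continuous_source (n := n) i).comp (continuous_snd (X := E n))
    have h2 := (continuous_dir (n := n) i).comp (continuous_snd (X := E n))
    exact ((continuous_fst.sub h1).sub (h2.const_smul r)).norm
  · rw [sub_source_moveLines, dir_moveLines, ← map_smul, ← map_sub,
      LinearIsometryEquiv.norm_map]
  -- The ray leaves the centre of the spheres radially; at the centre any unit vector will do, and
  -- the direction of the line provides one.
  · obtain ⟨u, hu, hw⟩ : ∃ u : E n, ‖u‖ = 1 ∧ y - L.source i - r • L.dir i
        = ‖y - L.source i - r • L.dir i‖ • u := by
      rcases eq_or_ne (y - L.source i - r • L.dir i) 0 with h0 | h0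
      · exact ⟨L.dir i, norm_dir L i, by simp [h0]⟩
      · refine ⟨‖y - L.source i - r • L.dir i‖⁻¹ • (y - L.source i - r • L.dir i), ?_, ?_⟩
        · rw [norm_smul, norm_inv, norm_norm, inv_mul_cancel₀ (norm_ne_zero_iff.2 h0)]
        · rw [smul_inv_smul₀ (norm_ne_zero_iff.2 h0)]
    refine ⟨fun t => y + t • u, by fun_prop, by simp, fun t ht => ?_⟩
    have e : y + t • u - L.source i - r • L.dir i
        = (‖y - L.source i - r • L.dir i‖ + t) • u := by
      rw [add_smul, ← hw]; abel
    rw [e, norm_smul, hu, mul_one, Real.norm_of_nonneg (by positivity)]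
  · rw [abs_norm]
    have h1 := norm_sub_le (y - L.source i) (r • L.dir i)
    have h2 := norm_sub_le y (L.source i)
    rw [norm_smul, norm_dir, mul_one, Real.norm_eq_abs] at h1
    linarith

theorem isRadonKernel_spatial {α : SplittingMap n k} (hα : α.IsInvariant) :
    IsRadonKernel (fun y L i => (α (y, L)).1 i)
      (fun y (L : LineSystem n k) i => ⟪y - L.source i, L.dir i⟫_ℝ) := by
  refine SplittingMap.isRadonKernel hα (fun i => ?_) (fun g y L i => ?_) (fun y L i => ?_)
    ⟨0, fun y L i => ?_⟩
  · have h1 := (continuous_source (n := n) i).comp (continuous_snd (X := E n))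
    have h2 := (continuous_dir (n := n) i).comp (continuous_snd (X := E n))
    exact (continuous_fst.sub h1).inner h2
  · rw [sub_source_moveLines, dir_moveLines, LinearIsometryEquiv.inner_map_map]
  · refine ⟨fun t => y + t • L.dir i, by fun_prop, by simp, fun t _ => ?_⟩
    rw [add_sub_right_comm, inner_add_left, real_inner_smul_left, real_inner_self_eq_norm_sq,
      norm_dir]
    ring
  · have h1 := abs_real_inner_le_norm (y - L.source i) (L.dir i)
    rw [norm_dir, mul_one] at h1
    linarith [norm_sub_le y (L.source i)]

end Kernels

/-! ### The circular distance. -/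

section Circular

variable {d k : ℕ} {G : SimpleGraph (Fin k)} {α : SplittingMap d k} {𝕋 : Set (TreeSystem d G)}
  {σ : Measure 𝕋} [IsProbabilityMeasure σ] [σ.IsOpenPosMeasure]

theorem isExtendedMetric_circularTSW (hG : G.IsTree) (hα : α.IsInvariant) (r : ℝ)
    (h𝕋 : IsEuclideanStable 𝕋) : IsExtendedMetric (circularTSW α r σ) := by
  refine (isRadonKernel_circular hα r).isExtendedMetric hG fun μ ν h =>
    (isRadonKernel_circular hα r).eq_of_radonTSW_eq_zero_of_proper hG h𝕋 (fun L i => ?_) h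
  refine ⟨‖L.source i + r • L.dir i‖, fun y => ?_⟩
  rw [abs_norm, sub_sub]
  have := norm_add_le (y - (L.source i + r • L.dir i)) (L.source i + r • L.dir i)
  rwa [sub_add_cancel] at this

end Circular

/-! ### The spatial distance, by reduction to the image measures under `h`. -/

section Spatial

variable {d e k : ℕ} {G : SimpleGraph (Fin k)} {α : SplittingMap e k} {h : E d → E e}

theorem splitAndProject_map {X Y : Type*} [MeasurableSpace X] [MeasurableSpace Y]
    {a c : Y → Fin k → ℝ} (ha : ∀ i, Measurable fun y => a y i)
    (hc : ∀ i, Measurable fun y => c y i) {f : X → Y} (hf : Measurable f) (μ : Measure X) :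
    splitAndProject (fun x => a (f x)) (fun x => c (f x)) μ = splitAndProject a c (μ.map f) := by
  refine Measure.ext_of_lintegral _ fun g hg => ?_
  rw [lintegral_splitAndProject (a := fun x => a (f x)) (c := fun x => c (f x)) _
      (fun i => (ha i).comp hf) (fun i => (hc i).comp hf) hg,
    lintegral_splitAndProject _ ha hc hg]
  refine Finset.sum_congr rfl fun i _ => ?_
  exact (lintegral_map (f := fun y => ENNReal.ofReal (a y i) * g (i, c y i))
    ((ha i).ennreal_ofReal.mul (hg.comp (measurable_const.prodMk (hc i)))) hf).symm

theorem spatialW_eq_radonW_map (hα : α.IsInvariant) (hh : Continuous h)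
    (μ ν : ProbabilityMeasure (E d)) (T : TreeSystem e G) :
    spatialW α h μ ν T = radonW (fun y L i => (α (y, L)).1 i)
      (fun y (L : LineSystem e k) i => ⟪y - L.source i, L.dir i⟫_ℝ)
      (μ.map hh.measurable.aemeasurable) (ν.map hh.measurable.aemeasurable) T := by
  have K := isRadonKernel_spatial hα
  have key := fun κ : ProbabilityMeasure (E d) =>
    splitAndProject_map (K.measurable_portion T.lines) (K.measurable_coord T.lines) hh.measurable
      (κ : Measure (E d))
  exact congrArg₂ (wasserstein (treeDist T)) (key μ) (key ν)

theorem spatialTSW_eq_radonTSW_map (hα : α.IsInvariant) (hh : Continuous h)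
    {𝕋 : Set (TreeSystem e G)} (σ : Measure 𝕋) (μ ν : ProbabilityMeasure (E d)) :
    spatialTSW α h σ μ ν = radonTSW (fun y L i => (α (y, L)).1 i)
      (fun y (L : LineSystem e k) i => ⟪y - L.source i, L.dir i⟫_ℝ) σ
      (μ.map hh.measurable.aemeasurable) (ν.map hh.measurable.aemeasurable) :=
  lintegral_congr fun T => spatialW_eq_radonW_map hα hh μ ν T.1

/-- A continuous injection between Polish spaces is a measurable embedding (Lusin–Souslin), so a
measure is recovered from its image by pulling back. -/
theorem map_injective_of_continuous_injective (hh : Continuous h) (hinj : Function.Injective h)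
    {μ ν : ProbabilityMeasure (E d)} (hμν : μ.map hh.measurable.aemeasurable
      = ν.map hh.measurable.aemeasurable) : μ = ν := by
  have he := hh.measurableEmbedding hinj
  have h1 : (μ : Measure (E d)).map h = (ν : Measure (E d)).map h :=
    congrArg ProbabilityMeasure.toMeasure hμν
  suffices hs : (μ : Measure (E d)) = ν from Subtype.ext hs
  rw [← he.comap_map μ, h1, he.comap_map]

theorem isExtendedMetric_spatialTSW (hG : G.IsTree) (hα : α.IsInvariant) (hh : Continuous h)
    (hinj : Function.Injective h) {𝕋 : Set (TreeSystem e G)} (h𝕋 : IsEuclideanStable 𝕋)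
    (σ : Measure 𝕋) [IsProbabilityMeasure σ] [σ.IsOpenPosMeasure] :
    IsExtendedMetric (spatialTSW α h σ) := by
  have K := isRadonKernel_spatial hα
  have hD := K.isExtendedMetric hG (σ := σ) fun μ ν hz =>
    K.eq_of_radonTSW_eq_zero_of_inner hG h𝕋 (fun _ _ _ => rfl) hz
  have e := spatialTSW_eq_radonTSW_map hα hh σ
  refine ⟨fun μ ν => ?_, fun μ ν => ?_, fun μ ν ρ => ?_⟩
  · rw [e, hD.eq_zero_iff]
    exact ⟨map_injective_of_continuous_injective hh hinj, fun hμν => by rw [hμν]⟩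
  · rw [e, e, hD.symm]
  · rw [e, e, e]; exact hD.triangle _ _ _

end Spatial

end TreeSliced

end

open TreeSliced
theorem mainTheorem4 (k : ℕ) (G : SimpleGraph (Fin k)) (hG : G.IsTree) (d : ℕ) :
    (∀ (α : SplittingMap d k), α.IsInvariant →
      ∀ (r : ℝ), 0 ≤ r →
      ∀ (𝕋 : Set (TreeSystem d G)), IsEuclideanStable 𝕋 →
      ∀ (σ : Measure 𝕋) [IsProbabilityMeasure σ] [σ.IsOpenPosMeasure],
        (∀ μ ν : ProbabilityMeasure (E d), Measurable fun T : 𝕋 => circularW α r μ ν T.1) ∧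
        IsExtendedMetric (circularTSW α r σ) ∧
        (TreeLawHasFirstMoment σ →
          IsMetricOn {μ : ProbabilityMeasure (E d) | Integrable (fun y => ‖y‖) (μ : Measure (E d))}
            (circularTSW α r σ))) ∧
    (∀ (e : ℕ) (h : E d → E e), Continuous h → Function.Injective h →
      ∀ (α : SplittingMap e k), α.IsInvariant →
      ∀ (𝕋 : Set (TreeSystem e G)), IsEuclideanStable 𝕋 →
      ∀ (σ : Measure 𝕋) [IsProbabilityMeasure σ] [σ.IsOpenPosMeasure],
        (∀ μ ν : ProbabilityMeasure (E d), Measurable fun T : 𝕋 => spatialW α h μ ν T.1) ∧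
        IsExtendedMetric (spatialTSW α h σ) ∧
        (TreeLawHasFirstMoment σ →
          IsMetricOn
            {μ : ProbabilityMeasure (E d) | Integrable (fun y => ‖h y‖) (μ : Measure (E d))}
            (spatialTSW α h σ))) := by
  constructor
  · intro α hα r _ 𝕋 h𝕋 σ _ _
    have K := isRadonKernel_circular hα r
    have hD : IsExtendedMetric (circularTSW α r σ) := isExtendedMetric_circularTSW hG hα r h𝕋
    exact ⟨fun μ ν => (K.measurable_radonW hG μ ν).comp measurable_subtype_coe, hD,
      fun hσ => hD.isMetricOn fun μ hμ ν hν => K.radonTSW_ne_top hG hσ hμ hν⟩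
  · intro e h hh hinj α hα 𝕋 h𝕋 σ _ _
    have K := isRadonKernel_spatial hα
    have hD := isExtendedMetric_spatialTSW hG hα hh hinj h𝕋 σ
    refine ⟨fun μ ν => ?_, hD, fun hσ => hD.isMetricOn fun μ hμ ν hν => ?_⟩
    · simp only [spatialW_eq_radonW_map hα hh]
      exact (K.measurable_radonW hG _ _).comp measurable_subtype_coe
    · rw [spatialTSW_eq_radonTSW_map hα hh]
      have hmap : ∀ κ : ProbabilityMeasure (E d),
          Integrable (fun y => ‖h y‖) (κ : Measure (E d)) →
          Integrable (fun y => ‖y‖)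
            (κ.map hh.measurable.aemeasurable : ProbabilityMeasure (E e)).toMeasure :=
        fun κ hκ => (integrable_map_measure continuous_norm.aestronglyMeasurable
          hh.measurable.aemeasurable).2 hκ
      exact K.radonTSW_ne_top hG hσ (hmap μ hμ) (hmap ν hν)
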